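/- **Setting.** For $E\subset\mathbb R^N$ let $$\operatorname{cap}(E)=\inf\Big\{\int_{\mathbb R^N}(|\nabla u|^2+u^2)\,dx:\ u\in H^1(\mathbb R^N),\ u\ge 1\text{ a.e. in a neighbourhood of }E\Big\}.$$ A property holds quasi-everywhere (q.e.) if it holds outside a set of capacity zero. A function $f$ is quasi-continuous if for every $\varepsilon>0$ there is a continuous $f_\varepsilon$ with $\operatorname{cap}(\{f\ne f_\varepsilon\})<\varepsilon$. Every $u\in H^1(\mathbb R^N)$ is identified with its quasi-continuous representative, which is unique q.e. A capacitary measure is a nonnegative Borel measure $\mu$ on $\mathbb R^N$, possibly taking the value $+\infty$, that vanishes on all sets of capacity zero. Put $$\|u\|_{1,\mu}^2=\int_{\mathbb R^N}(|\nabla u|^2+u^2)\,dx+\int_{\mathbb R^N}u^2\,d\mu,\qquad H^1_\mu=\{u\in H^1(\mathbb R^N):\|u\|_{1,\mu}<\infty\}.$$ For $S\subset\mathbb R^N$ let $\infty_S$ be the measure with $\infty_S(B)=0$ if $\operatorname{cap}(B\cap S)=0$ and $\infty_S(B)=+\infty$ otherwise, and for $R>0$ let $\mu\lceil B_R=\mu+\infty_{\mathbb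 R^N\setminus B_R}$, where $B_R$ is the open ball of radius $R$ centred at $0$. Let $u_R\in H^1_{\mu\lceil B_R}$ be the weak solution of $-\Delta u+u+(\mu\lceil B_R)u=1$, that is, $$\int_{\mathbb R^N}(\nabla u_R\cdot\nabla\varphi+u_R\varphi)\,dx+\int_{\mathbb R^N}u_R\varphi\,d(\mu\lceil B_R)=\int_{\mathbb R^N}\varphi\,dx\qquad\text{for all }\varphi\in H^1_{\mu\lceil B_R},$$ and define $w_\mu=\lim_{R\to+\infty}u_R$, meaning that $u_{r_n}\to w_\mu$ a.e. for every sequence $r_n\to+\infty$. **Theorem.** Let $\mu$ be a capacitary measure on $\mathbb R^N$. Then the limit $w_\mu$ exists, and the following assertions are equivalent: 1. $w_\mu\in L^1(\mathbb R^N)$; 2. $H^1_\mu\subset L^1(\mathbb R^N)$ with continuous injection, i.e. there is a constant $C$ with $\|u\|_{L^1(\mathbb R^N)}\le C\|u\|_{1,\mu}$ for all $u\in H^1_\mu$. Moreover, if one of the two assertions holds, then the embedding $H^1_\mu\hookrightarrow L^1(\mathbb R^N)$ is compact, i.e. every sequence bounded in $H^1_\mu$ has a subsequence that converges in $L^1(\mathbb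 R^N)$. -/

import Mathlib

open MeasureTheory Filter Topology
open scoped ENNReal NNReal ContDiff

noncomputable section

namespace CapacitarySobolev

/-- `ℝ^N` with its Euclidean norm. -/
abbrev Eu (N : ℕ) : Type := EuclideanSpace ℝ (Fin N)

variable {N : ℕ}

/-- `g` is a weak (distributional) gradient of `u` on `ℝ^N`. -/
def IsWeakGrad (u : Eu N → ℝ) (g : Eu N → Eu N) : Prop :=
  LocallyIntegrable u volume ∧ LocallyIntegrable g volume ∧
    ∀ φ : Eu N → ℝ, ContDiff ℝ ∞ φ → HasCompactSupport φ → ∀ v : Eu N,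
      ∫ x, u x * fderiv ℝ φ x v = -∫ x, inner ℝ (g x) v * φ x

/-- A (pointwise defined) function `u` represents an element of `H^1(ℝ^N)`. -/
def MemH1 (u : Eu N → ℝ) : Prop :=
  MemLp u 2 volume ∧ ∃ g : Eu N → Eu N, MemLp g 2 volume ∧ IsWeakGrad u g

open Classical in
/-- The weak gradient `∇u` of `u ∈ H^1(ℝ^N)`, unique up to Lebesgue null sets
(see `weakGrad_ae_eq`). -/
def weakGrad (u : Eu N → ℝ) : Eu N → Eu N :=
  if h : ∃ g : Eu N → Eu N, MemLp g 2 volume ∧ IsWeakGrad u g then h.choose else 0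

/-- Weak gradients are unique almost everywhere. -/
theorem IsWeakGrad.ae_eq {u : Eu N → ℝ} {g g' : Eu N → Eu N}
    (h : IsWeakGrad u g) (h' : IsWeakGrad u g') : g =ᵐ[volume] g' := by
  have hloc : LocallyIntegrable (g - g') volume := h.2.1.sub h'.2.1
  have key : ∀ᵐ x ∂(volume : Measure (Eu N)), (g - g') x = 0 := by
    refine ae_eq_zero_of_integral_contDiff_smul_eq_zero hloc ?_
    intro φ hφ hc
    have i1 : Integrable (fun x => φ x • g x) volume :=
      h.2.1.integrable_smul_left_of_hasCompactSupport hφ.continuous hc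
    have i2 : Integrable (fun x => φ x • g' x) volume :=
      h'.2.1.integrable_smul_left_of_hasCompactSupport hφ.continuous hc
    have e : ∫ x, φ x • (g - g') x = (∫ x, φ x • g x) - ∫ x, φ x • g' x := by
      rw [← integral_sub i1 i2]
      simp [smul_sub]
    rw [e, sub_eq_zero]
    refine ext_inner_left ℝ fun v => ?_
    rw [← integral_inner i1, ← integral_inner i2]
    have a1 := h.2.2 φ hφ hc v
    have a2 := h'.2.2 φ hφ hc v
    rw [a1, neg_inj] at a2
    simpa [inner_smul_right, real_inner_comm, mul_comm] using a2
  filter_upwards [key] with x hx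
  exact sub_eq_zero.1 hx

theorem weakGrad_ae_eq {u : Eu N → ℝ} {g : Eu N → Eu N} (hg : MemLp g 2 volume)
    (h : IsWeakGrad u g) : weakGrad u =ᵐ[volume] g := by
  have hex : ∃ g : Eu N → Eu N, MemLp g 2 volume ∧ IsWeakGrad u g := ⟨g, hg, h⟩
  have e : weakGrad u = hex.choose := by simp only [weakGrad, dif_pos hex]
  rw [e]
  exact hex.choose_spec.2.ae_eq h

/-- `∫ (|∇u|² + u²) dx`. -/
def h1Energy (u : Eu N → ℝ) : ℝ≥0∞ :=
  ∫⁻ x, (‖weakGrad u x‖ₑ ^ 2 + ‖u x‖ₑ ^ 2)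

/-- The class `U_E` of all `u ∈ H^1(ℝ^N)` with `u ≥ 1` a.e. in a neighbourhood of `E`. -/
def capAdmissible (E : Set (Eu N)) : Set (Eu N → ℝ) :=
  {u | MemH1 u ∧ ∃ U : Set (Eu N), IsOpen U ∧ E ⊆ U ∧ ∀ᵐ x, x ∈ U → 1 ≤ u x}

/-- The capacity of a set (`∞` if there is no admissible function). -/
def cap (E : Set (Eu N)) : ℝ≥0∞ :=
  ⨅ u ∈ capAdmissible E, h1Energy u

theorem cap_mono {A B : Set (Eu N)} (h : A ⊆ B) : cap A ≤ cap B := by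
  refine biInf_mono ?_
  rintro u ⟨hu, U, hU, hBU, hge⟩
  exact ⟨hu, U, hU, h.trans hBU, hge⟩

theorem cap_empty : cap (∅ : Set (Eu N)) = 0 := by
  have hw : IsWeakGrad (0 : Eu N → ℝ) 0 :=
    ⟨locallyIntegrable_zero, locallyIntegrable_zero, by simp⟩
  have hz : MemLp (0 : Eu N → Eu N) 2 volume := MemLp.zero
  have hmem : (0 : Eu N → ℝ) ∈ capAdmissible (∅ : Set (Eu N)) :=
    ⟨⟨MemLp.zero, 0, hz, hw⟩, ∅, isOpen_empty, subset_rfl, by simp⟩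
  have hE : h1Energy (0 : Eu N → ℝ) = 0 := by
    unfold h1Energy
    rw [← lintegral_zero (μ := (volume : Measure (Eu N)))]
    refine lintegral_congr_ae ?_
    filter_upwards [weakGrad_ae_eq hz hw] with x hx
    simp [hx]
  exact le_antisymm (hE ▸ iInf₂_le (0 : Eu N → ℝ) hmem) bot_le

/-- Quasi-continuity: for every `ε > 0`, `f` agrees with a continuous function outside a set
of capacity less than `ε`. -/
def QuasiContinuous (f : Eu N → ℝ) : Prop :=
  ∀ ε : ℝ≥0∞, 0 < ε → ∃ fε : Eu N → ℝ, Continuous fε ∧ cap {x | f x ≠ fε x} < ε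

/-- Capacitary measures: nonnegative Borel measures on `ℝ^N`, with values in `[0, ∞]` and
neither finite nor σ-finite in general, that vanish on all sets of capacity zero. -/
def IsCapacitary (μ : Measure (Eu N)) : Prop :=
  ∀ E : Set (Eu N), cap E = 0 → μ E = 0

open Classical in
/-- The set function `B ↦ 0` if `cap (B ∩ S) = 0`, `B ↦ ∞` otherwise. -/
def inftyFun (S B : Set (Eu N)) : ℝ≥0∞ := if cap (B ∩ S) = 0 then 0 else ⊤

theorem inftyFun_mono (S : Set (Eu N)) {A B : Set (Eu N)} (h : A ⊆ B) :
    inftyFun S A ≤ inftyFun S B := by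
  unfold inftyFun
  by_cases hB : cap (B ∩ S) = 0
  · have hA : cap (A ∩ S) = 0 :=
      le_antisymm (hB ▸ cap_mono (Set.inter_subset_inter_left S h)) bot_le
    simp [hA]
  · simp [hB]

theorem inftyFun_empty (S : Set (Eu N)) : inftyFun S ∅ = 0 := by
  simp [inftyFun, cap_empty]

/-- The measure `∞_S`, with `∞_S(B) = 0` if `cap (B ∩ S) = 0` and `∞_S(B) = ∞` otherwise.
It is built as the measure generated by this set function (the largest outer measure below
it); since countable unions of sets of capacity zero have capacity zero, the two coincide on
Borel sets. -/
def inftyMeasure (S : Set (Eu N)) : Measure (Eu N) :=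
  (OuterMeasure.ofFunction (inftyFun S) (inftyFun_empty S)).toMeasure (by
    intro s _
    refine OuterMeasure.ofFunction_caratheodory fun t => ?_
    by_cases ht : inftyFun S t = 0
    · have h1 := inftyFun_mono S (Set.inter_subset_left : t ∩ s ⊆ t)
      have h2 := inftyFun_mono S (Set.sdiff_subset : t \ s ⊆ t)
      rw [ht] at h1 h2 ⊢
      simp [le_antisymm h1 bot_le, le_antisymm h2 bot_le]
    · have ht' : inftyFun S t = ⊤ := by
        unfold inftyFun at ht ⊢
        split_ifs at ht ⊢ <;> simp_all
      rw [ht']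
      exact le_top)

/-- The Dirichlet restriction `μ⌈Ω = μ + ∞_{ℝ^N ∖ Ω}`. -/
def dirichletRestrict (μ : Measure (Eu N)) (Ω : Set (Eu N)) : Measure (Eu N) :=
  μ + inftyMeasure Ωᶜ

/-- `u` belongs to `H^1_μ = H^1(ℝ^N) ∩ L^2(μ)`. Elements of `H^1(ℝ^N)` are given by their
quasi-continuous representatives, which are determined up to sets of capacity zero. -/
def MemH1mu (μ : Measure (Eu N)) (u : Eu N → ℝ) : Prop :=
  MemH1 u ∧ QuasiContinuous u ∧ MemLp u 2 μ

/-- The norm `‖u‖_{1,μ} = (∫ (|∇u|² + u²) dx + ∫ u² dμ)^{1/2}`. -/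
def h1muNorm (μ : Measure (Eu N)) (u : Eu N → ℝ) : ℝ≥0∞ :=
  (h1Energy u + ∫⁻ x, ‖u x‖ₑ ^ 2 ∂μ) ^ (1 / 2 : ℝ)

/-- `u` is a weak solution of `-Δu + u + μ u = f`, `u ∈ H^1_μ`, where `φ ↦ ∫ f φ dx` is
defined on `H^1_μ`. -/
def IsWeakSolution (μ : Measure (Eu N)) (f u : Eu N → ℝ) : Prop :=
  MemH1mu μ u ∧ ∀ φ : Eu N → ℝ, MemH1mu μ φ →
    Integrable (fun x => f x * φ x) volume ∧
    (∫ x, (inner ℝ (weakGrad u x) (weakGrad φ x) + u x * φ x)) + ∫ x, u x * φ x ∂μ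
      = ∫ x, f x * φ x

/-- `w` is (a representative of) `w_μ = lim_{R → ∞} R_{μ⌈B_R}(1)`: for `R > 0` let `u_R` be
the weak solution of `-Δu + u + (μ⌈B_R) u = 1`; then `u_{r_n} → w` almost everywhere for
every sequence of radii `r_n → ∞`. -/
def IsLimitSolution (μ : Measure (Eu N)) (w : Eu N → ℝ) : Prop :=
  ∃ u : ℝ → Eu N → ℝ,
    (∀ R : ℝ, 0 < R →
      IsWeakSolution (dirichletRestrict μ (Metric.ball 0 R)) (fun _ => 1) (u R)) ∧
    ∀ r : ℕ → ℝ, Tendsto r atTop atTop →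
      ∀ᵐ x, Tendsto (fun n => u (r n) x) atTop (𝓝 (w x))

/-- `H^1_μ ⊆ L^1(ℝ^N)` with continuous injection. -/
def EmbedsContinuouslyL1 (μ : Measure (Eu N)) : Prop :=
  ∃ C : ℝ≥0, ∀ u : Eu N → ℝ, MemH1mu μ u →
    MemLp u 1 volume ∧ eLpNorm u 1 volume ≤ C * h1muNorm μ u

/-- `H^1_μ ⊆ L^1(ℝ^N)` with compact injection: every bounded sequence of `H^1_μ` has a
subsequence that converges in `L^1(ℝ^N)`. -/
def EmbedsCompactlyL1 (μ : Measure (Eu N)) : Prop :=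
  (∀ u : Eu N → ℝ, MemH1mu μ u → MemLp u 1 volume) ∧
  ∀ (C : ℝ≥0) (u : ℕ → Eu N → ℝ), (∀ n, MemH1mu μ (u n) ∧ h1muNorm μ (u n) ≤ C) →
    ∃ k : ℕ → ℕ, StrictMono k ∧ ∃ v : Eu N → ℝ, MemLp v 1 volume ∧
      Tendsto (fun n => eLpNorm (u (k n) - v) 1 volume) atTop (𝓝 0)

end CapacitarySobolev

end

open MeasureTheory Filter Topology
open scoped ENNReal NNReal ContDiff

noncomputable section

namespace CapacitarySobolev

variable {N : ℕ}

/-! ### Weak compactness and pairings in `L²` -/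

open scoped RealInnerProductSpace

/-! The problem is one about Hilbert spaces. A function of `H¹_μ` is recorded by the classes of `u`,
`∇u` and `u` modulo `μ` (`IsRep`), and the functions vanishing q.e. on a set `S` form a closed
subspace (`isClosed_vanishingSpace`): rapidly convergent sequences converge q.e., and `μ` does not
charge sets of capacity zero. The measure `∞_S` only encodes vanishing q.e. on `S`. Hence `u_R`
represents the functional `φ ↦ ∫ φ` on the functions vanishing q.e. outside `B_R`, and an orthogonal
projection produces it (`exists_isTorsion`). Truncation gives `0 ≤ u_R ≤ 1`, and testing with twice
the positive part of `u_R - u_R'` shows that `u_R` increases with `R` (`IsTorsion.ae_le`). So the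
limit exists.

Testing the equation with `u_R` itself gives `‖u_R‖² = ∫ u_R`. If the embedding has constant `C`,
then `‖u_R‖² ≤ C‖u_R‖`, so `∫ u_R ≤ C²`, and Fatou gives `w_μ ∈ L¹`. Conversely, if `φ` vanishes
q.e. outside `B_R`, then `∫ |φ| = ⟪u_R, |φ|⟫ ≤ ‖u_R‖ ‖φ‖ ≤ (∫ |w_μ|)^(1/2) ‖φ‖`; smooth cutoffs and
Fatou remove the restriction on `φ`.

For compactness, the embedding makes `u ↦ ∫ u` a bounded functional on all of `H¹_μ`, so Riesz
provides a representative `W`. Pairing `W` with `(1 - η)|u|`, where `η` is a cutoff, bounds the `L¹`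
mass of `u` far away by the `L²` tails of `W` times `‖u‖`, uniformly on bounded sets
(`exists_tight`). On balls, weak convergence in `H¹` gives strong convergence in `L¹`, by comparison
with averages over small balls (`exists_subseq_tendsto_ball`).

Lipschitz truncations are handled without a chain rule: membership in `H¹` amounts to bounded
difference quotients, which contractions do not increase. -/

/-- Bounded sequences in separable Hilbert spaces have weakly convergent subsequences. -/
theorem exists_weak_subseq {E : Type*} [NormedAddCommGroup E] [InnerProductSpace ℝ E]
    [CompleteSpace E] [TopologicalSpace.SeparableSpace E] {C : ℝ} {x : ℕ → E}
    (hx : ∀ n, ‖x n‖ ≤ C) :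
    ∃ k : ℕ → ℕ, StrictMono k ∧ ∃ a : E, ‖a‖ ≤ C ∧
      ∀ y, Tendsto (fun n => ⟪x (k n), y⟫) atTop (𝓝 ⟪a, y⟫) := by
  have hs := WeakDual.isSeqCompact_closedBall (𝕜 := ℝ) (E := E) 0 C
  obtain ⟨a, ha, k, hk, hlim⟩ := hs
    (x := fun n => StrongDual.toWeakDual (InnerProductSpace.toDual ℝ E (x n))) (by
      intro n
      simpa using hx n)
  refine ⟨k, hk, (InnerProductSpace.toDual ℝ E).symm (WeakDual.toStrongDual a), ?_, fun y => ?_⟩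
  · simpa using ha
  · have h := ((WeakDual.eval_continuous y).tendsto a).comp hlim
    simpa [Function.comp_def] using h

theorem abs_integral_mul_le {α : Type*} [MeasurableSpace α] {μ : Measure α} {f g : α → ℝ}
    (hf : MemLp f 2 μ) (hg : MemLp g 2 μ) :
    |∫ x, f x * g x ∂μ| ≤ (eLpNorm f 2 μ).toReal * (eLpNorm g 2 μ).toReal := by
  have h := abs_real_inner_le_norm (hf.toLp f) (hg.toLp g)
  rw [Lp.norm_toLp, Lp.norm_toLp, L2.inner_def] at h
  convert h using 2
  refine integral_congr_ae ?_
  filter_upwards [hf.coeFn_toLp, hg.coeFn_toLp] with x h1 h2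
  simp [h1, h2, mul_comm]

theorem inner_toLp_eq_integral {α : Type*} [MeasurableSpace α] {μ : Measure α} {f g : α → ℝ}
    (hf : MemLp f 2 μ) (hg : MemLp g 2 μ) :
    ⟪hf.toLp f, hg.toLp g⟫ = ∫ x, f x * g x ∂μ := by
  rw [L2.inner_def]
  refine integral_congr_ae ?_
  filter_upwards [hf.coeFn_toLp, hg.coeFn_toLp] with x h1 h2
  simp [h1, h2, mul_comm]

/-- A square integrable function is controlled by its pairings with test functions. -/
theorem eLpNorm_le_of_forall_test {F : Eu N → ℝ} (hF : MemLp F 2 volume) {C : ℝ} (hC : 0 ≤ C)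
    (h : ∀ φ : Eu N → ℝ, ContDiff ℝ ∞ φ → HasCompactSupport φ →
      |∫ x, F x * φ x| ≤ C * (eLpNorm φ 2 volume).toReal) :
    (eLpNorm F 2 volume).toReal ≤ C := by
  have key : ∀ f : Lp ℝ 2 (volume : Measure (Eu N)), |⟪hF.toLp F, f⟫| ≤ C * ‖f‖ := by
    intro f
    have hcl : IsClosed {f : Lp ℝ 2 (volume : Measure (Eu N)) | |⟪hF.toLp F, f⟫| ≤ C * ‖f‖} :=
      isClosed_le (by fun_prop) (by fun_prop)
    -- The estimate is a closed condition on the second argument, so it extends from the dense test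
    -- functions to all of `L²`; pairing `F` with itself then concludes.
    have hd := Lp.dense_hasCompactSupport_contDiff (E := Eu N) (F := ℝ)
      (μ := volume) (p := 2) (by simp)
    refine hcl.closure_subset_iff.2 ?_ (hd f)
    rintro f ⟨φ, hφ, hc, hs⟩
    have hm : MemLp φ 2 volume := hs.continuous.memLp_of_hasCompactSupport hc
    have : f = hm.toLp φ := by
      ext1
      exact hφ.trans hm.coeFn_toLp.symm
    simp only [Set.mem_ofPred_eq]
    rw [this, inner_toLp_eq_integral, Lp.norm_toLp]
    exact h φ hs hc
  have := key (hF.toLp F)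
  rw [real_inner_self_eq_norm_sq, abs_of_nonneg (sq_nonneg _), Lp.norm_toLp] at this
  by_contra! hlt
  nlinarith

/-! ### Translations and difference quotients -/

/-- Differentiating a translation under the integral sign. -/
theorem hasDerivAt_integral_mul_translate {f φ : Eu N → ℝ} (hf : LocallyIntegrable f volume)
    (hφ : ContDiff ℝ ∞ φ) (hc : HasCompactSupport φ) (e : Eu N) (t : ℝ) :
    HasDerivAt (fun t : ℝ => ∫ x, f x * φ (x - t • e))
      (-∫ x, f x * fderiv ℝ φ (x - t • e) e) t := by
  -- After reflection of `φ` the integral is the convolution of `f` with `k` at the point `t • e`,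
  -- which may be differentiated on the smooth factor.
  set k : Eu N → ℝ := fun z => φ (-z) with hk
  have hks : ContDiff ℝ ∞ k := hφ.comp contDiff_neg
  have hkc : HasCompactSupport k := hc.comp_homeomorph (Homeomorph.neg (Eu N))
  have hk' : ∀ z v, fderiv ℝ k z v = -fderiv ℝ φ (-z) v := by
    intro z v
    have h1 : HasFDerivAt φ (fderiv ℝ φ (-z)) (-z) :=
      ((hφ.differentiable (by simp)) (-z)).hasFDerivAt
    have h2 : HasFDerivAt (fun z : Eu N => -z) (-ContinuousLinearMap.id ℝ (Eu N)) z :=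
      (hasFDerivAt_id z).neg
    have h3 : fderiv ℝ k z = _ := (h1.comp z h2).fderiv
    rw [h3]
    simp
  have h := hkc.hasFDerivAt_convolution_right (ContinuousLinearMap.mul ℝ ℝ) hf
    (hks.of_le (by simp)) (t • e)
  have h2 : HasDerivAt (fun t : ℝ => t • e) e t := by
    simpa using (hasDerivAt_id t).smul_const e
  have h3 := h.comp_hasDerivAt t h2
  rw [convolution_precompR_apply _ hf (hkc.fderiv ℝ) (hks.continuous_fderiv (by simp))] at h3
  convert! h3 using 1
  · ext s
    simp [convolution, hk]
  · simp only [convolution, ContinuousLinearMap.mul_apply', hk', neg_sub, mul_neg, integral_neg]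

theorem memLp_translate {F : Type*} [NormedAddCommGroup F] {f : Eu N → F} {p : ℝ≥0∞}
    (hf : MemLp f p volume) (h : Eu N) : MemLp (fun x => f (x + h)) p volume :=
  hf.comp_measurePreserving (measurePreserving_add_right volume h)

theorem eLpNorm_translate {F : Type*} [NormedAddCommGroup F] {f : Eu N → F} {p : ℝ≥0∞}
    (hf : AEStronglyMeasurable f volume) (h : Eu N) :
    eLpNorm (fun x => f (x + h)) p volume = eLpNorm f p volume :=
  eLpNorm_comp_measurePreserving hf (measurePreserving_add_right volume h)

theorem integral_translate_sub_mul {f φ : Eu N → ℝ} (hf : MemLp f 2 volume)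
    (hφ : MemLp φ 2 volume) (h : Eu N) :
    ∫ x, (f (x + h) - f x) * φ x = (∫ x, f x * φ (x - h)) - ∫ x, f x * φ x := by
  have e : ∫ x, f x * φ (x - h) = ∫ x, f (x + h) * φ x := by
    rw [← integral_add_right_eq_self (fun x => f x * φ (x - h)) h]
    simp
  have e2 := integral_sub ((memLp_translate hf h).integrable_mul hφ) (hf.integrable_mul hφ)
  simp only [Pi.mul_apply] at e2
  rw [e, ← e2]
  simp [sub_mul]

/-- Difference quotients are bounded by the weak gradient. -/
theorem IsWeakGrad.eLpNorm_translate_sub_le {u : Eu N → ℝ} {g : Eu N → Eu N}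
    (hu : MemLp u 2 volume) (hg : MemLp g 2 volume) (h : IsWeakGrad u g) (e : Eu N) :
    (eLpNorm (fun x => u (x + e) - u x) 2 volume).toReal
      ≤ (eLpNorm (fun x => ⟪g x, e⟫) 2 volume).toReal := by
  refine eLpNorm_le_of_forall_test ((memLp_translate hu e).sub hu) ENNReal.toReal_nonneg ?_
  intro φ hφ hc
  have hφm : MemLp φ 2 volume := hφ.continuous.memLp_of_hasCompactSupport hc
  simp only [Pi.sub_apply]
  rw [integral_translate_sub_mul hu hφm]
  have hd : ∀ t ∈ Set.Icc (0 : ℝ) 1, HasDerivWithinAt (fun t : ℝ => ∫ x, u x * φ (x - t • e))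
      (-∫ x, u x * fderiv ℝ φ (x - t • e) e) (Set.Icc 0 1) t := fun t _ =>
    (hasDerivAt_integral_mul_translate h.1 hφ hc e t).hasDerivWithinAt
  -- Mean value inequality along `t ∈ [0, 1]`: the derivative is a pairing of `⟪g, e⟫` with a
  -- translate of `φ`, whose `L²` norm does not depend on `t`.
  have hb := norm_image_sub_le_of_norm_deriv_le_segment_01' hd
    (C := (eLpNorm (fun x => ⟪g x, e⟫) 2 volume).toReal * (eLpNorm φ 2 volume).toReal) (by
      intro t _
      have hφt : ContDiff ℝ ∞ (fun x => φ (x - t • e)) := hφ.comp (contDiff_id.sub contDiff_const)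
      have hct : HasCompactSupport (fun x => φ (x - t • e)) :=
        hc.comp_homeomorph (Homeomorph.subRight (t • e))
      have := h.2.2 _ hφt hct e
      simp only [fderiv_comp_sub] at this
      rw [this, neg_neg]
      refine (abs_integral_mul_le (hg.inner_const e)
        (hφt.continuous.memLp_of_hasCompactSupport hct)).trans_eq ?_
      congr 2
      simpa [sub_eq_add_neg] using eLpNorm_translate hφm.aestronglyMeasurable (-(t • e)))
  simpa using hb

/-- If the difference quotients of `F` in the direction `e` are bounded in `L²`, then `F` has a
weak derivative in that direction. -/
theorem exists_weak_deriv {F : Eu N → ℝ} (hF : MemLp F 2 volume) (e : Eu N) {C : ℝ}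
    (h : ∀ t : ℝ, 0 < t → (eLpNorm (fun x => F (x + t • e) - F x) 2 volume).toReal ≤ t * C) :
    ∃ G : Eu N → ℝ, MemLp G 2 volume ∧ (eLpNorm G 2 volume).toReal ≤ C ∧
      ∀ φ : Eu N → ℝ, ContDiff ℝ ∞ φ → HasCompactSupport φ →
        ∫ x, F x * fderiv ℝ φ x e = -∫ x, G x * φ x := by
  set t : ℕ → ℝ := fun n => 1 / ((n : ℝ) + 1) with ht
  have htpos : ∀ n, 0 < t n := fun n => by positivity
  have ht0 : Tendsto t atTop (𝓝 0) := tendsto_one_div_add_atTop_nhds_zero_nat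
  have hD : ∀ n, MemLp (fun x => F (x + t n • e) - F x) 2 volume := fun n =>
    (memLp_translate hF _).sub hF
  have : Fact ((2 : ℝ≥0∞) ≠ ⊤) := ⟨by simp⟩
  -- The difference quotients are bounded in `L²`; a weak limit is the derivative, since moving the
  -- quotient onto the test function turns it into a slope at `t = 0`.
  obtain ⟨k, hk, a, ha, hlim⟩ := exists_weak_subseq
    (x := fun n => (t n)⁻¹ • (hD n).toLp _) (C := C) (by
      intro n
      rw [norm_smul, Lp.norm_toLp, Real.norm_eq_abs, abs_of_pos (inv_pos.2 (htpos n)),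
        inv_mul_le_iff₀ (htpos n)]
      exact h _ (htpos n))
  refine ⟨a, Lp.memLp a, by rwa [← Lp.norm_def], fun φ hφ hc => ?_⟩
  have hφm : MemLp φ 2 volume := hφ.continuous.memLp_of_hasCompactSupport hc
  have h1 := hlim (hφm.toLp φ)
  have hd := hasDerivAt_integral_mul_translate (hF.locallyIntegrable (by norm_num)) hφ hc e 0
  have h2 := (hasDerivAt_iff_tendsto_slope_zero.1 hd).comp
    (tendsto_nhdsWithin_iff.2 ⟨ht0.comp hk.tendsto_atTop,
      Eventually.of_forall fun n => (htpos _).ne'⟩)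
  have h3 : ∀ n, ⟪(t n)⁻¹ • (hD n).toLp _, hφm.toLp φ⟫
      = (t n)⁻¹ • ((∫ x, F x * φ (x - t n • e)) - ∫ x, F x * φ x) := by
    intro n
    rw [real_inner_smul_left, inner_toLp_eq_integral, integral_translate_sub_mul hF hφm]
    rfl
  have h4 := tendsto_nhds_unique (h1.congr fun n => h3 (k n)) (by
    simpa [Function.comp_def] using h2)
  have h5 : ⟪a, hφm.toLp φ⟫ = ∫ x, a x * φ x := by
    conv_lhs => rw [← Lp.toLp_coeFn a (Lp.memLp a)]
    rw [inner_toLp_eq_integral]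
  rw [← h5, h4]
  simp

theorem eLpNorm_two_sq {α F : Type*} [MeasurableSpace α] [NormedAddCommGroup F] {μ : Measure α}
    (f : α → F) : eLpNorm f 2 μ ^ 2 = ∫⁻ x, ‖f x‖ₑ ^ 2 ∂μ := by
  have h := eLpNorm_nnreal_pow_eq_lintegral (f := f) (μ := μ) (p := 2) (by norm_num)
  have e : ((2 : ℝ≥0) : ℝ≥0∞) = 2 := by norm_num
  rw [e] at h
  norm_num at h
  exact_mod_cast h

theorem memLp_smul_const {α F : Type*} [MeasurableSpace α] {μ : Measure α}
    [NormedAddCommGroup F] [NormedSpace ℝ F] {f : α → ℝ} {p : ℝ≥0∞} (hf : MemLp f p μ) (v : F) :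
    MemLp (fun x => f x • v) p μ :=
  (ContinuousLinearMap.toSpanSingleton ℝ v).comp_memLp' hf

theorem memLp_fderiv_apply {φ : Eu N → ℝ} (hφ : ContDiff ℝ ∞ φ) (hc : HasCompactSupport φ)
    (v : Eu N) : MemLp (fun x => fderiv ℝ φ x v) 2 volume :=
  ((hφ.continuous_fderiv (by simp)).clm_apply continuous_const).memLp_of_hasCompactSupport
    (hc.fderiv_apply ℝ v)

theorem memLp_test {φ : Eu N → ℝ} (hφ : ContDiff ℝ ∞ φ) (hc : HasCompactSupport φ) :
    MemLp φ 2 (volume : Measure (Eu N)) :=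
  hφ.continuous.memLp_of_hasCompactSupport hc

/-! ### Calculus of weak gradients -/

theorem isWeakGrad_of_memLp {u : Eu N → ℝ} {g : Eu N → Eu N} (hu : MemLp u 2 volume)
    (hg : MemLp g 2 volume)
    (h : ∀ φ : Eu N → ℝ, ContDiff ℝ ∞ φ → HasCompactSupport φ → ∀ v : Eu N,
      ∫ x, u x * fderiv ℝ φ x v = -∫ x, ⟪g x, v⟫ * φ x) : IsWeakGrad u g :=
  ⟨hu.locallyIntegrable (by norm_num), hg.locallyIntegrable (by norm_num), h⟩

theorem IsWeakGrad.congr {u u' : Eu N → ℝ} {g g' : Eu N → Eu N} (h : IsWeakGrad u g)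
    (hu : u =ᵐ[volume] u') (hg : g =ᵐ[volume] g') : IsWeakGrad u' g' := by
  refine ⟨fun x => (h.1 x).congr hu, fun x => (h.2.1 x).congr hg, fun φ hφ hc v => ?_⟩
  have e1 : ∫ x, u x * fderiv ℝ φ x v = ∫ x, u' x * fderiv ℝ φ x v :=
    integral_congr_ae (hu.mono fun x hx => by simp only [hx])
  have e2 : ∫ x, ⟪g x, v⟫ * φ x = ∫ x, ⟪g' x, v⟫ * φ x :=
    integral_congr_ae (hg.mono fun x hx => by simp only [hx])
  rw [← e1, ← e2, h.2.2 φ hφ hc v]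

theorem IsWeakGrad.add {u u' : Eu N → ℝ} {g g' : Eu N → Eu N} (hu : MemLp u 2 volume)
    (hg : MemLp g 2 volume) (hu' : MemLp u' 2 volume) (hg' : MemLp g' 2 volume)
    (h : IsWeakGrad u g) (h' : IsWeakGrad u' g') : IsWeakGrad (u + u') (g + g') := by
  refine isWeakGrad_of_memLp (hu.add hu') (hg.add hg') fun φ hφ hc v => ?_
  have d := memLp_fderiv_apply hφ hc v
  have m := memLp_test hφ hc
  have e1 := integral_add (hu.integrable_mul d) (hu'.integrable_mul d)
  have e2 := integral_add ((hg.inner_const v).integrable_mul m) ((hg'.inner_const v).integrable_mul m)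
  simp only [Pi.mul_apply] at e1 e2
  simp only [Pi.add_apply, add_mul, inner_add_left]
  rw [e1, e2, h.2.2 φ hφ hc v, h'.2.2 φ hφ hc v]
  ring

theorem IsWeakGrad.smul {u : Eu N → ℝ} {g : Eu N → Eu N} (h : IsWeakGrad u g) (c : ℝ) :
    IsWeakGrad (c • u) (c • g) := by
  refine ⟨h.1.smul c, h.2.1.smul c, fun φ hφ hc v => ?_⟩
  simp only [Pi.smul_apply, smul_eq_mul, real_inner_smul_left, mul_assoc]
  rw [integral_const_mul, integral_const_mul, h.2.2 φ hφ hc v]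
  ring

theorem isWeakGrad_zero : IsWeakGrad (0 : Eu N → ℝ) 0 :=
  ⟨locallyIntegrable_zero, locallyIntegrable_zero, by simp⟩

/-- The graph of the weak gradient is closed in `L² × L²`. -/
theorem isClosed_setOf_isWeakGrad :
    IsClosed {p : Lp ℝ 2 (volume : Measure (Eu N)) × Lp (Eu N) 2 (volume : Measure (Eu N)) |
      IsWeakGrad p.1 p.2} := by
  -- Each test function and direction contributes the equality of two continuous functionals, so the
  -- graph is an intersection of closed sets.
  have e : {p : Lp ℝ 2 (volume : Measure (Eu N)) × Lp (Eu N) 2 (volume : Measure (Eu N)) |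
      IsWeakGrad p.1 p.2} = ⋂ (φ : Eu N → ℝ) (hφ : ContDiff ℝ ∞ φ) (hc : HasCompactSupport φ)
        (v : Eu N), {p | ⟪p.1, (memLp_fderiv_apply hφ hc v).toLp _⟫
          = -⟪p.2, (memLp_smul_const (memLp_test hφ hc) v).toLp _⟫} := by
    ext p
    simp only [Set.mem_iInter, Set.mem_ofPred_eq]
    have k : ∀ (φ : Eu N → ℝ) (hφ : ContDiff ℝ ∞ φ) (hc : HasCompactSupport φ) (v : Eu N),
        ⟪p.1, (memLp_fderiv_apply hφ hc v).toLp _⟫ = ∫ x, p.1 x * fderiv ℝ φ x v ∧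
        ⟪p.2, (memLp_smul_const (memLp_test hφ hc) v).toLp _⟫ = ∫ x, ⟪p.2 x, v⟫ * φ x := by
      intro φ hφ hc v
      constructor
      · rw [L2.inner_def]
        refine integral_congr_ae ?_
        filter_upwards [(memLp_fderiv_apply hφ hc v).coeFn_toLp] with x hx
        simp [hx, mul_comm]
      · rw [L2.inner_def]
        refine integral_congr_ae ?_
        filter_upwards [(memLp_smul_const (memLp_test hφ hc) v).coeFn_toLp] with x hx
        simp [hx, real_inner_smul_right, mul_comm]
    constructor
    · intro h φ hφ hc v
      rw [(k φ hφ hc v).1, (k φ hφ hc v).2]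
      exact h.2.2 φ hφ hc v
    · intro h
      refine isWeakGrad_of_memLp (Lp.memLp _) (Lp.memLp _) fun φ hφ hc v => ?_
      rw [← (k φ hφ hc v).1, ← (k φ hφ hc v).2]
      exact h φ hφ hc v
  rw [e]
  refine isClosed_iInter fun φ => isClosed_iInter fun hφ => isClosed_iInter fun hc =>
    isClosed_iInter fun v => isClosed_eq (by fun_prop) (by fun_prop)

/-- Product rule, obtained by testing the weak gradient of `u` with `χ φ`. Since `χ` is only smooth,
without bounds, the square integrability of the products is assumed. -/
theorem IsWeakGrad.mul {u χ : Eu N → ℝ} {g : Eu N → Eu N} (hu : MemLp u 2 volume)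
    (hg : MemLp g 2 volume) (h : IsWeakGrad u g) (hχ : ContDiff ℝ ∞ χ)
    (hχu : MemLp (fun x => χ x * u x) 2 volume)
    (hg' : MemLp (fun x => χ x • g x + u x • gradient χ x) 2 volume) :
    IsWeakGrad (fun x => χ x * u x) (fun x => χ x • g x + u x • gradient χ x) := by
  refine isWeakGrad_of_memLp hχu hg' fun φ hφ hc v => ?_
  have hs : ContDiff ℝ ∞ (fun x => χ x * φ x) := hχ.mul hφ
  have hsc : HasCompactSupport (fun x => χ x * φ x) := hc.mul_left
  have key := h.2.2 _ hs hsc v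
  have hd : ∀ x, fderiv ℝ (fun x => χ x * φ x) x v
      = χ x * fderiv ℝ φ x v + φ x * fderiv ℝ χ x v := by
    intro x
    rw [fderiv_fun_mul (hχ.differentiable (by simp) x) (hφ.differentiable (by simp) x)]
    simp
  have hψ : MemLp (fun x => φ x * fderiv ℝ χ x v) 2 volume :=
    (hφ.continuous.mul ((hχ.continuous_fderiv (by simp)).clm_apply
      continuous_const)).memLp_of_hasCompactSupport hc.mul_right
  have hd' := memLp_fderiv_apply hφ hc v
  have i1 : Integrable (fun x => u x * (φ x * fderiv ℝ χ x v)) volume := hu.integrable_mul hψ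
  have i2 : Integrable (fun x => (χ x * u x) * fderiv ℝ φ x v) volume := hχu.integrable_mul hd'
  have i3 : Integrable (fun x => ⟪g x, v⟫ * (χ x * φ x)) volume :=
    (hg.inner_const v).integrable_mul (memLp_test hs hsc)
  have e1 : ∫ x, u x * fderiv ℝ (fun x => χ x * φ x) x v
      = (∫ x, (χ x * u x) * fderiv ℝ φ x v) + ∫ x, u x * (φ x * fderiv ℝ χ x v) := by
    rw [← integral_add i2 i1]
    refine integral_congr_ae (.of_forall fun x => ?_)
    simp only [hd]
    ring
  have e2 : ∫ x, ⟪χ x • g x + u x • gradient χ x, v⟫ * φ x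
      = (∫ x, ⟪g x, v⟫ * (χ x * φ x)) + ∫ x, u x * (φ x * fderiv ℝ χ x v) := by
    rw [← integral_add i3 i1]
    refine integral_congr_ae (.of_forall fun x => ?_)
    simp only [inner_add_left, real_inner_smul_left, gradient, InnerProductSpace.toDual_symm_apply]
    ring
  rw [e2]
  linarith

/-- Normal contractions operate on `H¹`. -/
theorem IsWeakGrad.exists_comp_contraction {u : Eu N → ℝ} {g : Eu N → Eu N}
    (hu : MemLp u 2 volume) (hg : MemLp g 2 volume) (h : IsWeakGrad u g) {T : ℝ → ℝ}
    (hT : LipschitzWith 1 T) (hT0 : T 0 = 0) :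
    ∃ g' : Eu N → Eu N, MemLp g' 2 volume ∧ IsWeakGrad (T ∘ u) g' ∧
      eLpNorm g' 2 volume ≤ eLpNorm g 2 volume := by
  have hTu : MemLp (T ∘ u) 2 volume := hT.comp_memLp hT0 hu
  set b := EuclideanSpace.basisFun (Fin N) ℝ with hb
  -- Composition with `T` does not increase difference quotients, so each partial derivative exists
  -- and has at most the `L²` norm of that of `u`. Summing squares over an orthonormal basis bounds
  -- the gradient.
  have key : ∀ i, ∃ G : Eu N → ℝ, MemLp G 2 volume ∧
      (eLpNorm G 2 volume).toReal ≤ (eLpNorm (fun x => ⟪g x, b i⟫) 2 volume).toReal ∧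
      ∀ φ : Eu N → ℝ, ContDiff ℝ ∞ φ → HasCompactSupport φ →
        ∫ x, (T ∘ u) x * fderiv ℝ φ x (b i) = -∫ x, G x * φ x := by
    intro i
    refine exists_weak_deriv hTu (b i) fun t ht => ?_
    calc (eLpNorm (fun x => (T ∘ u) (x + t • b i) - (T ∘ u) x) 2 volume).toReal
        ≤ (eLpNorm (fun x => u (x + t • b i) - u x) 2 volume).toReal := by
          refine ENNReal.toReal_mono ((memLp_translate hu _).sub hu).eLpNorm_ne_top ?_
          refine eLpNorm_mono fun x => ?_
          simpa using hT.norm_sub_le (u (x + t • b i)) (u x)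
      _ ≤ (eLpNorm (fun x => ⟪g x, t • b i⟫) 2 volume).toReal :=
          h.eLpNorm_translate_sub_le hu hg _
      _ = t * (eLpNorm (fun x => ⟪g x, b i⟫) 2 volume).toReal := by
          have : (fun x => ⟪g x, t • b i⟫) = t • (fun x => ⟪g x, b i⟫) := by
            ext x
            simp [real_inner_smul_right]
          rw [this, eLpNorm_const_smul, ENNReal.toReal_mul]
          simp [abs_of_pos ht]
  choose G hG hGle hGw using key
  set g' : Eu N → Eu N := fun x => ∑ i, G i x • b i with hg'
  have hg'm : MemLp g' 2 volume := memLp_finsetSum _ fun i _ => memLp_smul_const (hG i) (b i)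
  have hin : ∀ x i, ⟪g' x, b i⟫ = G i x := by
    intro x i
    simp [hg', sum_inner, real_inner_smul_left, b.inner_eq_ite]
  have hnorm : ∀ f : Eu N → Eu N, MemLp f 2 volume →
      eLpNorm f 2 volume ^ 2 = ∑ i, eLpNorm (fun x => ⟪f x, b i⟫) 2 volume ^ 2 := by
    intro f hf
    simp only [eLpNorm_two_sq]
    rw [← lintegral_finsetSum']
    · refine lintegral_congr fun x => ?_
      have := b.sum_sq_norm_inner_left (f x)
      simp only [← ofReal_norm]
      simp only [← ENNReal.ofReal_pow (norm_nonneg _)]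
      rw [← ENNReal.ofReal_sum_of_nonneg (fun i _ => by positivity), ← this]
    · intro i _
      exact ((hf.inner_const (b i)).aestronglyMeasurable.enorm.pow_const 2)
  refine ⟨g', hg'm, isWeakGrad_of_memLp hTu hg'm fun φ hφ hc v => ?_, ?_⟩
  · have hv : v = ∑ i, ⟪b i, v⟫ • b i := (b.sum_repr' v).symm
    have h1 : ∀ x, (T ∘ u) x * fderiv ℝ φ x v
        = ∑ i, ⟪b i, v⟫ * ((T ∘ u) x * fderiv ℝ φ x (b i)) := by
      intro x
      conv_lhs => rw [hv]
      simp only [map_sum, map_smul, smul_eq_mul, Finset.mul_sum]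
      refine Finset.sum_congr rfl fun i _ => by ring
    have h2 : ∀ x, ⟪g' x, v⟫ * φ x = ∑ i, ⟪b i, v⟫ * (G i x * φ x) := by
      intro x
      conv_lhs => rw [hv]
      simp only [inner_sum, real_inner_smul_right, hin, Finset.sum_mul]
      refine Finset.sum_congr rfl fun i _ => by ring
    simp only [h1, h2]
    rw [integral_finsetSum, integral_finsetSum, ← Finset.sum_neg_distrib]
    · refine Finset.sum_congr rfl fun i _ => ?_
      rw [integral_const_mul, integral_const_mul, hGw i φ hφ hc]
      ring
    · exact fun i _ => ((hG i).integrable_mul (memLp_test hφ hc)).const_mul _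
    · exact fun i _ => (hTu.integrable_mul (memLp_fderiv_apply hφ hc (b i))).const_mul _
  · have : eLpNorm g' 2 volume ^ 2 ≤ eLpNorm g 2 volume ^ 2 := by
      rw [hnorm g' hg'm, hnorm g hg]
      refine Finset.sum_le_sum fun i _ => ?_
      gcongr
      simp only [hin]
      exact (ENNReal.toReal_le_toReal (hG i).eLpNorm_ne_top
        (hg.inner_const (b i)).eLpNorm_ne_top).1 (hGle i)
    exact (ENNReal.pow_le_pow_left_iff two_ne_zero).1 this

/-! ### `H¹` functions as vectors of a Hilbert space -/

/-- Pairs of a square integrable function and a square integrable vector field. -/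
abbrev H1Pair (N : ℕ) : Type :=
  WithLp 2 (Lp ℝ 2 (volume : Measure (Eu N)) × Lp (Eu N) 2 (volume : Measure (Eu N)))

/-- `p` consists of the classes of `u` and of its weak gradient. -/
def IsH1Rep (u : Eu N → ℝ) (p : H1Pair N) : Prop :=
  u =ᵐ[volume] p.fst ∧ IsWeakGrad u p.snd

namespace IsH1Rep

variable {u v : Eu N → ℝ} {p q : H1Pair N}

theorem memLp (h : IsH1Rep u p) : MemLp u 2 volume := (Lp.memLp p.fst).ae_eq h.1.symm

theorem memH1 (h : IsH1Rep u p) : MemH1 u := ⟨h.memLp, p.snd, Lp.memLp _, h.2⟩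

theorem weakGrad_ae_eq (h : IsH1Rep u p) : weakGrad u =ᵐ[volume] p.snd :=
  CapacitarySobolev.weakGrad_ae_eq (Lp.memLp _) h.2

theorem add (h : IsH1Rep u p) (h' : IsH1Rep v q) : IsH1Rep (u + v) (p + q) := by
  constructor
  · filter_upwards [h.1, h'.1, Lp.coeFn_add p.fst q.fst] with x h1 h2 h3
    rw [WithLp.add_fst, h3]
    simp [h1, h2]
  · exact (h.2.add h.memLp (Lp.memLp _) h'.memLp (Lp.memLp _) h'.2).congr ae_eq_rfl
      (Lp.coeFn_add p.snd q.snd).symm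

theorem smul (h : IsH1Rep u p) (c : ℝ) : IsH1Rep (c • u) (c • p) := by
  constructor
  · filter_upwards [h.1, Lp.coeFn_smul c p.fst] with x h1 h3
    rw [WithLp.smul_fst, h3]
    simp [h1]
  · exact (h.2.smul c).congr ae_eq_rfl (Lp.coeFn_smul c p.snd).symm

theorem sub (h : IsH1Rep u p) (h' : IsH1Rep v q) : IsH1Rep (u - v) (p - q) := by
  have := h.add (h'.smul (-1))
  simpa [sub_eq_add_neg] using this

theorem congr (h : IsH1Rep u p) (e : u =ᵐ[volume] v) : IsH1Rep v p :=
  ⟨e.symm.trans h.1, h.2.congr e ae_eq_rfl⟩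

/-- The class of a function in `H¹` is unique. -/
theorem unique (h : IsH1Rep u p) (h' : IsH1Rep u q) : p = q := by
  have e1 : p.fst = q.fst := Lp.ext (h.1.symm.trans h'.1)
  have e2 : p.snd = q.snd := Lp.ext (h.2.ae_eq h'.2)
  exact WithLp.ofLp_injective 2 (Prod.ext e1 e2)

theorem exists_comp_contraction (h : IsH1Rep u p) {T : ℝ → ℝ} (hT : LipschitzWith 1 T)
    (hT0 : T 0 = 0) :
    ∃ q : H1Pair N, IsH1Rep (T ∘ u) q ∧ ‖q.fst‖ ≤ ‖p.fst‖ ∧ ‖q.snd‖ ≤ ‖p.snd‖ := by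
  obtain ⟨g', hg', hw, hle⟩ := h.2.exists_comp_contraction h.memLp (Lp.memLp _) hT hT0
  have hTu : MemLp (T ∘ u) 2 volume := hT.comp_memLp hT0 h.memLp
  refine ⟨WithLp.toLp 2 (hTu.toLp _, hg'.toLp _), ⟨hTu.coeFn_toLp.symm,
    hw.congr ae_eq_rfl hg'.coeFn_toLp.symm⟩, ?_, ?_⟩
  · refine Lp.norm_le_norm_of_ae_le ?_
    filter_upwards [hTu.coeFn_toLp, h.1] with x h1 h2
    rw [show (WithLp.toLp 2 (hTu.toLp (T ∘ u), hg'.toLp g')).fst = hTu.toLp (T ∘ u) from rfl,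
      h1, ← h2]
    simpa [hT0] using hT.norm_sub_le (u x) 0
  · change ‖hg'.toLp g'‖ ≤ ‖p.snd‖
    rw [Lp.norm_toLp, Lp.norm_def]
    exact ENNReal.toReal_mono (Lp.eLpNorm_ne_top _) hle

theorem norm_le_of_components {p q : H1Pair N} (h1 : ‖q.fst‖ ≤ ‖p.fst‖)
    (h2 : ‖q.snd‖ ≤ ‖p.snd‖) : ‖q‖ ≤ ‖p‖ := by
  rw [WithLp.prod_norm_eq_of_L2, WithLp.prod_norm_eq_of_L2]
  exact Real.sqrt_le_sqrt (by gcongr)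

theorem exists_abs (h : IsH1Rep u p) : ∃ q : H1Pair N, IsH1Rep (fun x => |u x|) q ∧ ‖q‖ ≤ ‖p‖ := by
  obtain ⟨q, hq, h1, h2⟩ := h.exists_comp_contraction (T := fun t => |t|)
    (.of_dist_le_mul fun a b => by simpa [Real.dist_eq] using abs_abs_sub_abs_le a b) (by simp)
  exact ⟨q, hq, norm_le_of_components h1 h2⟩

theorem h1Energy_eq (h : IsH1Rep u p) : h1Energy u = ‖p‖ₑ ^ 2 := by
  have e1 : ‖p‖ₑ ^ 2 = ‖p.fst‖ₑ ^ 2 + ‖p.snd‖ₑ ^ 2 := by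
    simp only [← ofReal_norm, ← ENNReal.ofReal_pow (norm_nonneg _)]
    rw [WithLp.prod_norm_sq_eq_of_L2, ENNReal.ofReal_add (by positivity) (by positivity)]
  rw [e1, Lp.enorm_def, Lp.enorm_def, eLpNorm_two_sq, eLpNorm_two_sq, add_comm,
    ← lintegral_add_right' _ ((Lp.aestronglyMeasurable p.fst).enorm.pow_const 2)]
  refine lintegral_congr_ae ?_
  filter_upwards [h.weakGrad_ae_eq, h.1] with x h1 h2
  rw [h1, h2]

end IsH1Rep

theorem MemH1.exists_isH1Rep {u : Eu N → ℝ} (h : MemH1 u) : ∃ p, IsH1Rep u p := by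
  obtain ⟨hu, g, hg, hw⟩ := h
  exact ⟨WithLp.toLp 2 (hu.toLp _, hg.toLp _), hu.coeFn_toLp.symm,
    hw.congr ae_eq_rfl hg.coeFn_toLp.symm⟩

theorem isH1Rep_zero : IsH1Rep (0 : Eu N → ℝ) 0 :=
  ⟨(Lp.coeFn_zero _ _ _).symm, isWeakGrad_zero.congr ae_eq_rfl (Lp.coeFn_zero _ _ _).symm⟩

theorem isClosed_setOf_isWeakGrad_pair :
    IsClosed {p : H1Pair N | IsWeakGrad p.fst p.snd} :=
  isClosed_setOf_isWeakGrad.preimage (WithLp.prod_continuous_ofLp 2 _ _)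

/-! ### Capacity -/

theorem cap_le_of_isH1Rep {u : Eu N → ℝ} {p : H1Pair N} (h : IsH1Rep u p) {E U : Set (Eu N)}
    (hU : IsOpen U) (hE : E ⊆ U) (h1 : ∀ᵐ x, x ∈ U → 1 ≤ u x) : cap E ≤ ‖p‖ₑ ^ 2 := by
  rw [← h.h1Energy_eq]
  exact iInf₂_le u ⟨h.memH1, U, hU, hE, h1⟩

theorem exists_admissible_of_cap_lt {E : Set (Eu N)} {δ : ℝ} (hδ : 0 ≤ δ)
    (h : cap E < ENNReal.ofReal δ ^ 2) :
    ∃ (u : Eu N → ℝ) (p : H1Pair N) (U : Set (Eu N)), IsH1Rep u p ∧ ‖p‖ ≤ δ ∧ IsOpen U ∧ E ⊆ U ∧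
      ∀ᵐ x, x ∈ U → 1 ≤ u x := by
  simp only [cap, iInf_lt_iff] at h
  obtain ⟨u, ⟨hu, U, hU, hE, h1⟩, hlt⟩ := h
  obtain ⟨p, hp⟩ := hu.exists_isH1Rep
  refine ⟨u, p, U, hp, ?_, hU, hE, h1⟩
  rw [hp.h1Energy_eq] at hlt
  have := (ENNReal.pow_le_pow_left_iff two_ne_zero).1 hlt.le
  rw [← ofReal_norm] at this
  exact (ENNReal.ofReal_le_ofReal_iff hδ).1 this

/-- An admissible function for `E` is admissible for the whole neighbourhood on which it is at least
`1`. -/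
theorem exists_isOpen_cap_lt {E : Set (Eu N)} {ε : ℝ≥0∞} (h : cap E < ε) :
    ∃ U, IsOpen U ∧ E ⊆ U ∧ cap U < ε := by
  simp only [cap, iInf_lt_iff] at h
  obtain ⟨u, ⟨hu, U, hU, hE, h1⟩, hlt⟩ := h
  exact ⟨U, hU, hE, (iInf₂_le u ⟨hu, U, hU, subset_rfl, h1⟩).trans_lt hlt⟩

/-- The energy dominates `∫ u²`, and `u² ≥ 1` on a neighbourhood of `E`. Thus quasi-everywhere
statements hold almost everywhere. -/
theorem volume_le_cap (E : Set (Eu N)) : volume E ≤ cap E := by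
  refine le_iInf₂ fun u hu => ?_
  obtain ⟨hu, U, hU, hE, h1⟩ := hu
  calc volume E ≤ volume U := measure_mono hE
    _ = ∫⁻ x in U, 1 := by simp
    _ ≤ ∫⁻ x in U, (‖weakGrad u x‖ₑ ^ 2 + ‖u x‖ₑ ^ 2) := by
        refine lintegral_mono_ae ?_
        filter_upwards [(ae_restrict_iff' hU.measurableSet).2 h1] with x hx
        refine le_add_left ?_
        have : (1 : ℝ≥0∞) ≤ ‖u x‖ₑ := by
          rw [Real.enorm_eq_ofReal_abs, ENNReal.one_le_ofReal]
          exact hx.trans (le_abs_self _)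
        exact one_le_pow₀ this
    _ ≤ h1Energy u := setLIntegral_le_lintegral _ _

theorem ae_of_cap_eq_zero {P : Eu N → Prop} (h : cap {x | ¬ P x} = 0) : ∀ᵐ x, P x :=
  le_antisymm ((volume_le_cap _).trans h.le) bot_le

/-- Countable subadditivity of the square root of the capacity. -/
theorem cap_iUnion_le_of_summable {u : ℕ → Eu N → ℝ} {p : ℕ → H1Pair N} {U : ℕ → Set (Eu N)}
    (h : ∀ n, IsH1Rep (u n) (p n)) (hU : ∀ n, IsOpen (U n))
    (h1 : ∀ n, ∀ᵐ x, x ∈ U n → 1 ≤ |u n x|) {c : ℕ → ℝ} {s : ℝ} (hc : ∀ n, ‖p n‖ ≤ c n)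
    (hs : HasSum c s) : cap (⋃ n, U n) ≤ ENNReal.ofReal s ^ 2 := by
  -- Passing to absolute values makes the series one of nonnegative functions, so its sum dominates
  -- every term and is admissible for the union.
  choose q hq hqp using fun n => (h n).exists_abs
  have hqc : ∀ n, ‖q n‖ ≤ c n := fun n => (hqp n).trans (hc n)
  have hsum : Summable q := .of_norm_bounded hs.summable hqc
  have hP : IsWeakGrad (∑' n, q n).fst (∑' n, q n).snd := by
    refine isClosed_setOf_isWeakGrad_pair.mem_of_tendsto hsum.hasSum (.of_forall fun t => ?_)
    have : IsH1Rep (∑ n ∈ t, fun x => |u n x|) (∑ n ∈ t, q n) := by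
      induction t using Finset.cons_induction with
      | empty => simpa using isH1Rep_zero
      | cons a t ha ih =>
        rw [Finset.sum_cons, Finset.sum_cons]
        exact (hq a).add ih
    exact this.2.congr this.1 ae_eq_rfl
  have hle : ∀ n, (q n).fst ≤ (∑' n, q n).fst := by
    have hs1 : HasSum (fun n => (q n).fst) (∑' n, q n).fst :=
      (WithLp.fstL 2 ℝ _ _).hasSum hsum.hasSum
    intro n
    refine le_hasSum hs1 n fun m _ => ?_
    rw [← Lp.coeFn_nonneg]
    filter_upwards [(hq m).1] with x hx
    rw [← hx]
    exact abs_nonneg _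
  refine (cap_le_of_isH1Rep (p := ∑' n, q n) ⟨ae_eq_rfl, hP⟩ (isOpen_iUnion hU) subset_rfl
    ?_).trans ?_
  · have h2 := ae_all_iff.2 h1
    have h3 : ∀ᵐ x, ∀ n, |u n x| ≤ (∑' n, q n).fst x := by
      refine ae_all_iff.2 fun n => ?_
      filter_upwards [(Lp.coeFn_le _ _).2 (hle n), (hq n).1] with x hx hx'
      rwa [hx']
    filter_upwards [h2, h3] with x h2 h3 hx
    obtain ⟨n, hn⟩ := Set.mem_iUnion.1 hx
    exact (h2 n hn).trans (h3 n)
  · gcongr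
    rw [← ofReal_norm]
    exact ENNReal.ofReal_le_ofReal (tsum_of_norm_bounded hs hqc)

theorem exists_cap_iUnion_lt (N : ℕ) {ε : ℝ≥0∞} (hε : 0 < ε) :
    ∃ δ : ℕ → ℝ≥0∞, (∀ n, 0 < δ n) ∧
      ∀ E : ℕ → Set (Eu N), (∀ n, cap (E n) < δ n) → cap (⋃ n, E n) < ε := by
  -- The thresholds below have square roots summing to `r`, so the union has capacity at most `r²`;
  -- this is at most `r < ε` because `r < 1`.
  obtain ⟨r, hr0, hr⟩ := ENNReal.lt_iff_exists_nnreal_btwn.1 (lt_min hε one_pos)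
  have hr0' : (0 : ℝ) < r := by exact_mod_cast hr0
  refine ⟨fun n => ENNReal.ofReal (r / 2 / 2 ^ n) ^ 2, fun n => ?_, fun E hE => ?_⟩
  · have : (0 : ℝ) < r / 2 / 2 ^ n := by positivity
    exact ENNReal.pow_pos (ENNReal.ofReal_pos.2 this) 2
  · choose u p U hp hle hU hEU h1 using fun n =>
      exists_admissible_of_cap_lt (by positivity) (hE n)
    have := cap_iUnion_le_of_summable hp hU
      (fun n => (h1 n).mono fun x hx hxU => (hx hxU).trans (le_abs_self _)) hle
      (hasSum_geometric_two' (r : ℝ))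
    refine (cap_mono (Set.iUnion_mono hEU)).trans_lt (this.trans_lt ?_)
    rw [ENNReal.ofReal_coe_nnreal]
    have hr1 : (r : ℝ≥0∞) ≤ 1 := (hr.trans_le (min_le_right _ _)).le
    calc (r : ℝ≥0∞) ^ 2 ≤ r := by
          rw [sq]
          exact mul_le_of_le_one_left' hr1
      _ < ε := hr.trans_le (min_le_left _ _)

theorem cap_iUnion_eq_zero {E : ℕ → Set (Eu N)} (h : ∀ n, cap (E n) = 0) :
    cap (⋃ n, E n) = 0 := by
  by_contra hne
  obtain ⟨δ, hδ, H⟩ := exists_cap_iUnion_lt N (pos_iff_ne_zero.2 hne)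
  exact (H E fun n => by rw [h n]; exact hδ n).false

theorem exists_cap_union_lt (N : ℕ) {ε : ℝ≥0∞} (hε : 0 < ε) :
    ∃ δ : ℝ≥0∞, 0 < δ ∧
      ∀ A B : Set (Eu N), cap A < δ → cap B < δ → cap (A ∪ B) < ε := by
  obtain ⟨δ, hδ, H⟩ := exists_cap_iUnion_lt N hε
  refine ⟨min (δ 0) (δ 1), lt_min (hδ 0) (hδ 1), fun A B hA hB => ?_⟩
  refine (cap_mono ?_).trans_lt (H (fun n => if n = 0 then A else if n = 1 then B else ∅) ?_)
  · refine Set.union_subset (fun x hx => Set.mem_iUnion.2 ⟨0, by simpa⟩)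
      (fun x hx => Set.mem_iUnion.2 ⟨1, by simpa⟩)
  · intro n
    by_cases h0 : n = 0
    · subst h0
      simpa using hA.trans_le (min_le_left _ _)
    by_cases h1 : n = 1
    · subst h1
      simpa using hB.trans_le (min_le_right _ _)
    simp [h0, h1, cap_empty, hδ]

theorem cap_union_eq_zero {A B : Set (Eu N)} (hA : cap A = 0) (hB : cap B = 0) :
    cap (A ∪ B) = 0 := by
  by_contra hne
  obtain ⟨δ, hδ, H⟩ := exists_cap_union_lt N (pos_iff_ne_zero.2 hne)
  exact (H A B (hA ▸ hδ) (hB ▸ hδ)).false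

theorem cap_eq_zero_of_subset {A B : Set (Eu N)} (h : A ⊆ B) (hB : cap B = 0) : cap A = 0 :=
  le_antisymm ((cap_mono h).trans hB.le) bot_le

/-! ### Quasi-continuity -/

theorem quasiContinuous_of_continuous {f : Eu N → ℝ} (h : Continuous f) : QuasiContinuous f :=
  fun ε hε => ⟨f, h, by simpa [cap_empty] using hε⟩

theorem QuasiContinuous.map₂ {f g : Eu N → ℝ} (hf : QuasiContinuous f) (hg : QuasiContinuous g)
    {Φ : ℝ → ℝ → ℝ} (hΦ : Continuous (Function.uncurry Φ)) :
    QuasiContinuous (fun x => Φ (f x) (g x)) := by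
  intro ε hε
  obtain ⟨δ, hδ, H⟩ := exists_cap_union_lt N hε
  obtain ⟨f', hf', hcf⟩ := hf δ hδ
  obtain ⟨g', hg', hcg⟩ := hg δ hδ
  refine ⟨fun x => Φ (f' x) (g' x), hΦ.comp (hf'.prodMk hg'), ?_⟩
  refine (cap_mono fun x hx => ?_).trans_lt (H _ _ hcf hcg)
  by_contra hcon
  simp only [Set.mem_union, Set.mem_ofPred_eq, not_or, not_not] at hcon
  exact hx (by simp only [hcon.1, hcon.2])

theorem QuasiContinuous.add {f g : Eu N → ℝ} (hf : QuasiContinuous f) (hg : QuasiContinuous g) :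
    QuasiContinuous (f + g) :=
  hf.map₂ hg (Φ := fun a b => a + b) continuous_add

theorem QuasiContinuous.comp_continuous {f : Eu N → ℝ} (hf : QuasiContinuous f) {T : ℝ → ℝ}
    (hT : Continuous T) : QuasiContinuous (T ∘ f) :=
  hf.map₂ hf (Φ := fun a _ => T a) (hT.comp continuous_fst)

theorem QuasiContinuous.smul {f : Eu N → ℝ} (hf : QuasiContinuous f) (c : ℝ) :
    QuasiContinuous (c • f) :=
  hf.comp_continuous (T := fun t => c * t) (by fun_prop)

theorem QuasiContinuous.mul {f g : Eu N → ℝ} (hf : QuasiContinuous f) (hg : QuasiContinuous g) :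
    QuasiContinuous (fun x => f x * g x) :=
  hf.map₂ hg (Φ := fun a b => a * b) continuous_mul

/-- Quasi-continuous functions that vanish almost everywhere vanish quasi-everywhere. -/
theorem QuasiContinuous.cap_ne_zero_eq_zero {f : Eu N → ℝ} (hf : QuasiContinuous f)
    (h : f =ᵐ[volume] 0) : cap {x | f x ≠ 0} = 0 := by
  by_contra hne
  obtain ⟨g, hg, hlt⟩ := hf _ (pos_iff_ne_zero.2 hne)
  have := hlt
  simp only [cap, iInf_lt_iff] at this
  obtain ⟨a, ⟨ha, U, hU, hE, h1⟩, hlt'⟩ := this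
  refine (lt_of_le_of_lt ?_ hlt').false
  -- Almost every point of the open set `{g ≠ 0}` has `f = 0 ≠ g`, hence lies in `U`. Adding this
  -- set to `U` leaves `a` admissible but covers `{f ≠ 0}`, so the capacity would lie strictly below
  -- itself.
  refine iInf₂_le a ⟨ha, {x | g x ≠ 0} ∪ U, (isOpen_ne_fun hg continuous_const).union hU, ?_, ?_⟩
  · intro x hx
    by_cases hxg : f x = g x
    · exact Or.inl (by simpa [← hxg] using hx)
    · exact Or.inr (hE hxg)
  · filter_upwards [h, h1] with x hx h1 hmem
    by_cases hxg : f x = g x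
    · rcases hmem with hmem | hmem
      · exact absurd (hxg.symm.trans hx) hmem
      · exact h1 hmem
    · exact h1 (hE hxg)

/-- Rapidly Cauchy sequences of quasi-continuous functions in `H¹` converge quasi-everywhere to
a quasi-continuous function. -/
theorem exists_quasiContinuous_limit {u : ℕ → Eu N → ℝ} {p : ℕ → H1Pair N}
    (h : ∀ n, IsH1Rep (u n) (p n)) (hqc : ∀ n, QuasiContinuous (u n))
    (hp : ∀ n, ‖p (n + 1) - p n‖ ≤ (1 / 4) ^ n) :
    ∃ v : Eu N → ℝ, QuasiContinuous v ∧
      cap {x | ¬ Tendsto (fun n => u n x) atTop (𝓝 (v x))} = 0 := by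
  have hpos : ∀ n : ℕ, (0 : ℝ) < (1 / 4) ^ n := fun n => by positivity
  choose f hf hcapf using fun n =>
    hqc n (ENNReal.ofReal ((1 / 4) ^ n) ^ 2) (ENNReal.pow_pos (ENNReal.ofReal_pos.2 (hpos n)) 2)
  choose a q U hq hqle hU hAU h1 using fun n => exists_admissible_of_cap_lt (hpos n).le (hcapf n)
  have hfu : ∀ n x, x ∉ U n → u n x = f n x := by
    intro n x hx
    by_contra hne
    exact hx (hAU n hne)
  -- The bad open set at stage `n`: either the continuous approximants jump by more than `2⁻ⁿ`, or
  -- one of them may differ from the original function.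
  set W : ℕ → Set (Eu N) := fun n =>
    {x | (1 / 2 : ℝ) ^ n < |f (n + 1) x - f n x|} ∪ (U n ∪ U (n + 1)) with hW
  have hWo : ∀ n, IsOpen (W n) := fun n =>
    (isOpen_lt continuous_const ((hf (n + 1)).sub (hf n)).abs).union ((hU n).union (hU (n + 1)))
  -- This function is at least `1` on `W n`, through the first term at jumps and through `a` on the
  -- sets `U`. Its norm is of order `2ⁿ · 4⁻ⁿ = 2⁻ⁿ`, hence summable.
  set b : ℕ → Eu N → ℝ := fun n =>
    (2 : ℝ) ^ n • (fun x => |(u (n + 1) - u n) x|) + ((fun x => |a n x|) + fun x => |a (n + 1) x|)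
    with hb
  have hbr : ∀ n, ∃ r : H1Pair N, IsH1Rep (b n) r ∧ ‖r‖ ≤ 3 * (1 / 2) ^ n := by
    intro n
    obtain ⟨r1, hr1, hl1⟩ := ((h (n + 1)).sub (h n)).exists_abs
    obtain ⟨r2, hr2, hl2⟩ := (hq n).exists_abs
    obtain ⟨r3, hr3, hl3⟩ := (hq (n + 1)).exists_abs
    refine ⟨_, (hr1.smul (2 ^ n)).add (hr2.add hr3), ?_⟩
    have e : (2 : ℝ) ^ n * (1 / 4) ^ n = (1 / 2) ^ n := by
      rw [← mul_pow]
      norm_num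
    have e1 : ((1 : ℝ) / 4) ^ n ≤ (1 / 2) ^ n := by gcongr; norm_num
    have e2 : ((1 : ℝ) / 4) ^ (n + 1) ≤ (1 / 2) ^ n := by
      rw [pow_succ]
      nlinarith [hpos n]
    have e3 : ‖(2 : ℝ) ^ n • r1‖ ≤ (1 / 2) ^ n := by
      rw [norm_smul, norm_pow, Real.norm_ofNat, ← e]
      gcongr
      exact hl1.trans (hp n)
    calc ‖(2 : ℝ) ^ n • r1 + (r2 + r3)‖ ≤ ‖(2 : ℝ) ^ n • r1‖ + (‖r2‖ + ‖r3‖) :=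
          (norm_add_le _ _).trans (by gcongr; exact norm_add_le _ _)
      _ ≤ (1 / 2) ^ n + ((1 / 2) ^ n + (1 / 2) ^ n) := by
          gcongr
          · exact (hl2.trans (hqle n)).trans e1
          · exact (hl3.trans (hqle (n + 1))).trans e2
      _ = _ := by ring
  choose r hr hrle using hbr
  have hb1 : ∀ n, ∀ᵐ x, x ∈ W n → 1 ≤ |b n x| := by
    intro n
    filter_upwards [h1 n, h1 (n + 1)] with x ha ha' hx
    have hbx : b n x = 2 ^ n * |u (n + 1) x - u n x| + (|a n x| + |a (n + 1) x|) := by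
      simp [hb]
    have hnn : 0 ≤ (2 : ℝ) ^ n * |u (n + 1) x - u n x| := by positivity
    have hn1 := abs_nonneg (a n x)
    have hn2 := abs_nonneg (a (n + 1) x)
    refine le_trans ?_ (le_abs_self _)
    rw [hbx]
    by_cases m1 : x ∈ U n
    · linarith [ha m1, le_abs_self (a n x)]
    by_cases m2 : x ∈ U (n + 1)
    · linarith [ha' m2, le_abs_self (a (n + 1) x)]
    have m3 : (1 / 2 : ℝ) ^ n < |f (n + 1) x - f n x| := by
      rcases hx with hx | hx | hx
      · exact hx
      · exact absurd hx m1
      · exact absurd hx m2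
    rw [hfu n x m1, hfu (n + 1) x m2]
    have : (2 : ℝ) ^ n * (1 / 2) ^ n = 1 := by
      rw [← mul_pow]
      norm_num
    have := mul_lt_mul_of_pos_left m3 (show (0 : ℝ) < 2 ^ n by positivity)
    linarith
  set G : ℕ → Set (Eu N) := fun m => ⋃ n, W (m + n) with hG
  have hGo : ∀ m, IsOpen (G m) := fun m => isOpen_iUnion fun n => hWo _
  have hGcap : ∀ m, cap (G m) ≤ ENNReal.ofReal (6 * (1 / 2) ^ m) ^ 2 := by
    intro m
    have hs : HasSum (fun n : ℕ => 3 * (1 / 2 : ℝ) ^ (m + n)) (6 * (1 / 2) ^ m) := by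
      have := hasSum_geometric_two.mul_left (3 * (1 / 2 : ℝ) ^ m)
      convert! this using 1
      · ext n
        rw [pow_add]
        ring
      · ring
    exact cap_iUnion_le_of_summable (fun n => hr (m + n)) (fun n => hWo (m + n))
      (fun n => hb1 (m + n)) (fun n => hrle (m + n)) hs
  have hGlim : Tendsto (fun m : ℕ => ENNReal.ofReal (6 * (1 / 2) ^ m) ^ 2) atTop (𝓝 0) := by
    have h1 : Tendsto (fun m : ℕ => 6 * (1 / 2 : ℝ) ^ m) atTop (𝓝 (6 * 0)) :=
      (tendsto_pow_atTop_nhds_zero_of_lt_one (by norm_num) (by norm_num)).const_mul 6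
    have h2 := ((ENNReal.continuous_pow 2).tendsto _).comp ((ENNReal.continuous_ofReal.tendsto _).comp h1)
    simpa [Function.comp_def] using h2
  have hoff : ∀ m x, x ∉ G m → ∀ n, u (m + n) x = f (m + n) x ∧
      dist (u (m + n) x) (u (m + (n + 1)) x) ≤ (2 * (1 / 2) ^ m) / 2 / 2 ^ n := by
    intro m x hx n
    have hxn : ∀ n, x ∉ W (m + n) := fun n hn => hx (Set.mem_iUnion.2 ⟨n, hn⟩)
    have hxU : ∀ n, x ∉ U (m + n) := fun n hn => hxn n (Or.inr (Or.inl hn))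
    refine ⟨hfu _ x (hxU n), ?_⟩
    have h2 : ¬ (1 / 2 : ℝ) ^ (m + n) < |f (m + n + 1) x - f (m + n) x| :=
      fun hn => hxn n (Or.inl hn)
    have h3 := not_lt.1 h2
    rw [← hfu _ x (hxU n), show f (m + n + 1) x = u (m + (n + 1)) x from
      (hfu _ x (hxU (n + 1))).symm] at h3
    rw [dist_comm, Real.dist_eq]
    refine h3.trans_eq ?_
    rw [pow_add]
    field_simp
    rw [← mul_pow]
    norm_num
  have hconv : ∀ m x, x ∉ G m → ∃ l, Tendsto (fun n => u n x) atTop (𝓝 l) := by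
    intro m x hx
    have hc := cauchySeq_of_le_geometric_two (fun n => (hoff m x hx n).2)
    obtain ⟨l, hl⟩ := cauchySeq_tendsto_of_complete hc
    refine ⟨l, (tendsto_add_atTop_iff_nat m).1 ?_⟩
    simpa only [add_comm] using hl
  classical
  set v : Eu N → ℝ := fun x =>
    if hx : ∃ l, Tendsto (fun n => u n x) atTop (𝓝 l) then hx.choose else 0 with hv
  have hvlim : ∀ m x, x ∉ G m → Tendsto (fun n => u n x) atTop (𝓝 (v x)) := by
    intro m x hx
    have hex := hconv m x hx
    simp only [hv, dif_pos hex]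
    exact hex.choose_spec
  refine ⟨v, fun ε hε => ?_, ?_⟩
  · obtain ⟨m, hm⟩ := (hGlim.eventually_lt_const hε).exists
    -- Off `G m` the tail consists of continuous functions converging uniformly, at a geometric
    -- rate; the continuous limit on this closed set is then extended by Tietze.
    have hcont : ContinuousOn v (G m)ᶜ := by
      have hunif : TendstoUniformlyOn (fun n => f (m + n)) v atTop (G m)ᶜ := by
        rw [Metric.tendstoUniformlyOn_iff]
        intro δ hδ
        have hl : Tendsto (fun n : ℕ => 2 * (1 / 2 : ℝ) ^ m / 2 ^ n) atTop (𝓝 0) :=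
          tendsto_const_nhds.div_atTop (tendsto_pow_atTop_atTop_of_one_lt (by norm_num))
        filter_upwards [hl.eventually_lt_const hδ] with n hn x hx
        rw [dist_comm, ← (hoff m x hx n).1]
        refine lt_of_le_of_lt ?_ hn
        refine dist_le_of_le_geometric_two_of_tendsto (f := fun n => u (m + n) x)
          (fun n => (hoff m x hx n).2) ?_ n
        have := (tendsto_add_atTop_iff_nat m).2 (hvlim m x hx)
        simpa only [add_comm] using this
      exact hunif.continuousOn (Frequently.of_forall fun n => (hf (m + n)).continuousOn)
    obtain ⟨g, hg⟩ := ContinuousMap.exists_restrict_eq (hGo m).isClosed_compl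
      ⟨_, hcont.domRestrict⟩
    refine ⟨g, g.continuous, ((cap_mono fun x hx => ?_).trans (hGcap m)).trans_lt hm⟩
    by_contra hxG
    refine hx ?_
    have := congrArg (fun F => F ⟨x, hxG⟩) hg
    simpa using this.symm
  · refine le_antisymm (ge_of_tendsto' hGlim fun m => ?_) bot_le
    refine (cap_mono fun x hx => ?_).trans (hGcap m)
    by_contra hxG
    exact hx (hvlim m x hxG)

/-! ### The measures `∞_S` -/

/-- The set function takes only the values `0` and `∞`, so a countable cover with finite sum
consists of pieces that meet `S` in capacity zero. -/
theorem cap_inter_eq_zero_of_inftyMeasure_ne_top {S E : Set (Eu N)}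
    (h : inftyMeasure S E ≠ ⊤) : cap (E ∩ S) = 0 := by
  have h1 : OuterMeasure.ofFunction (inftyFun S) (inftyFun_empty S) E < ⊤ :=
    (le_toMeasure_apply _ _ _).trans_lt h.lt_top
  rw [OuterMeasure.ofFunction_apply] at h1
  simp only [iInf_lt_iff] at h1
  obtain ⟨t, ht, hlt⟩ := h1
  have h0 : ∀ n, cap (t n ∩ S) = 0 := by
    intro n
    have hn : inftyFun S (t n) ≠ ⊤ := ((ENNReal.le_tsum n).trans_lt hlt).ne
    by_contra hc
    exact hn (by simp [inftyFun, hc])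
  refine cap_eq_zero_of_subset ?_ (cap_iUnion_eq_zero h0)
  rw [← Set.iUnion_inter]
  exact Set.inter_subset_inter_left _ ht

/-- Open neighbourhoods of capacity tending to zero intersect in a `G_δ` set of capacity zero. -/
theorem exists_measurable_superset_cap_eq_zero {E : Set (Eu N)} (h : cap E = 0) :
    ∃ A, E ⊆ A ∧ MeasurableSet A ∧ cap A = 0 := by
  have h1 : ∀ n : ℕ, ∃ U : Set (Eu N), IsOpen U ∧ E ⊆ U ∧ cap U < ((n : ℝ≥0∞) + 1)⁻¹ := fun n =>
    exists_isOpen_cap_lt (by rw [h]; simp)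
  choose U hU hEU hlt using h1
  refine ⟨⋂ n, U n, Set.subset_iInter hEU, .iInter fun n => (hU n).measurableSet, ?_⟩
  by_contra hne
  obtain ⟨n, hn⟩ := ENNReal.exists_inv_nat_lt hne
  have := ((cap_mono (Set.iInter_subset U n)).trans_lt (hlt n)).trans_le
    (ENNReal.inv_le_inv.2 (le_self_add (a := (n : ℝ≥0∞)) (b := 1)))
  exact (this.trans hn).false

theorem inftyMeasure_le_of_measurableSet {S A : Set (Eu N)} (hA : MeasurableSet A)
    (h : cap (A ∩ S) = 0) : inftyMeasure S A = 0 := by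
  have : inftyMeasure S A ≤ inftyFun S A := by
    rw [inftyMeasure, toMeasure_apply _ _ hA]
    exact OuterMeasure.ofFunction_le A
  refine le_antisymm (this.trans ?_) bot_le
  simp [inftyFun, h]

theorem inftyMeasure_eq_zero {S E : Set (Eu N)} (hS : MeasurableSet S)
    (h : cap (E ∩ S) = 0) : inftyMeasure S E = 0 := by
  obtain ⟨A, hEA, hA, hcA⟩ := exists_measurable_superset_cap_eq_zero h
  have hsub : E ⊆ Sᶜ ∪ A := by
    intro x hx
    by_cases hxS : x ∈ S
    · exact Or.inr (hEA ⟨hx, hxS⟩)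
    · exact Or.inl hxS
  refine measure_mono_null hsub (measure_union_null ?_ ?_)
  · exact inftyMeasure_le_of_measurableSet hS.compl (by simp [cap_empty])
  · exact inftyMeasure_le_of_measurableSet hA
      (cap_eq_zero_of_subset Set.inter_subset_left hcA)

/-- `u = 0` quasi-everywhere on `S`. -/
def VanishesQE (S : Set (Eu N)) (u : Eu N → ℝ) : Prop := cap ({x | u x ≠ 0} ∩ S) = 0

theorem VanishesQE.ae_inftyMeasure {S : Set (Eu N)} {u : Eu N → ℝ} (hS : MeasurableSet S)
    (h : VanishesQE S u) : u =ᵐ[inftyMeasure S] 0 :=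
  inftyMeasure_eq_zero hS h

/-- By Chebyshev the sets `{|u| ≥ 1/(n+1)}` have finite `∞_S` measure, so they meet `S` in capacity
zero; their union is `{u ≠ 0}`. -/
theorem vanishesQE_of_memLp {S : Set (Eu N)} {u : Eu N → ℝ}
    (h : MemLp u 2 (inftyMeasure S)) : VanishesQE S u := by
  have h1 : ∀ n : ℕ, cap ({x | ((n : ℝ≥0) + 1)⁻¹ ≤ ‖u x‖₊} ∩ S) = 0 := fun n =>
    cap_inter_eq_zero_of_inftyMeasure_ne_top
      (h.meas_ge_lt_top (by norm_num) (by norm_num) (by positivity)).ne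
  refine cap_eq_zero_of_subset ?_ (cap_iUnion_eq_zero h1)
  rintro x ⟨hx, hxS⟩
  have hpos : 0 < ‖u x‖₊ := by simpa [pos_iff_ne_zero] using hx
  obtain ⟨n, hn⟩ := exists_nat_one_div_lt hpos
  exact Set.mem_iUnion.2 ⟨n, by simpa using hn.le, hxS⟩

theorem VanishesQE.ae_volume {S : Set (Eu N)} {u : Eu N → ℝ} (h : VanishesQE S u) :
    ∀ᵐ x, x ∈ S → u x = 0 := by
  refine ae_of_cap_eq_zero (cap_eq_zero_of_subset (fun x hx => ?_) h)
  simp only [Set.mem_ofPred_eq, Classical.not_imp] at hx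
  exact ⟨hx.2, hx.1⟩

theorem VanishesQE.of_imp {S : Set (Eu N)} {u v : Eu N → ℝ} (h : VanishesQE S u)
    (hv : ∀ x, u x = 0 → v x = 0) : VanishesQE S v :=
  cap_eq_zero_of_subset (Set.inter_subset_inter_left _ fun x hx hu => hx (hv x hu)) h

theorem VanishesQE.of_imp₂ {S : Set (Eu N)} {u v w : Eu N → ℝ} (hu : VanishesQE S u)
    (hv : VanishesQE S v) (hw : ∀ x, u x = 0 → v x = 0 → w x = 0) : VanishesQE S w := by
  refine cap_eq_zero_of_subset (fun x hx => ?_) (cap_union_eq_zero hu hv)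
  by_cases h : u x = 0
  · exact Or.inr ⟨fun h' => hx.1 (hw x h h'), hx.2⟩
  · exact Or.inl ⟨h, hx.2⟩

theorem VanishesQE.mono {S S' : Set (Eu N)} {u : Eu N → ℝ} (h : VanishesQE S u) (hs : S' ⊆ S) :
    VanishesQE S' u :=
  cap_eq_zero_of_subset (Set.inter_subset_inter_right _ hs) h

theorem vanishesQE_empty (u : Eu N → ℝ) : VanishesQE ∅ u := by
  simp [VanishesQE, cap_empty]

/-- Replaces the infinite measure by a linear constraint, so that all radii share the ambient space
`H1muPair μ`. -/
theorem memH1mu_dirichletRestrict_iff {μ : Measure (Eu N)} {Ω : Set (Eu N)}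
    (hΩ : MeasurableSet Ω) {u : Eu N → ℝ} :
    MemH1mu (dirichletRestrict μ Ω) u ↔ MemH1mu μ u ∧ VanishesQE Ωᶜ u := by
  constructor
  · rintro ⟨h1, h2, h3⟩
    exact ⟨⟨h1, h2, h3.left_of_add_measure⟩, vanishesQE_of_memLp h3.right_of_add_measure⟩
  · rintro ⟨⟨h1, h2, h3⟩, h4⟩
    have h5 := h4.ae_inftyMeasure hΩ.compl
    refine ⟨h1, h2, ?_, ?_⟩
    · exact h3.1.add_measure ((aestronglyMeasurable_const (b := (0 : ℝ))).congr h5.symm)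
    · have : eLpNorm u 2 (dirichletRestrict μ Ω) ^ 2 = eLpNorm u 2 μ ^ 2 := by
        rw [eLpNorm_two_sq, eLpNorm_two_sq, dirichletRestrict, lintegral_add_measure]
        have : ∫⁻ x, ‖u x‖ₑ ^ 2 ∂(inftyMeasure Ωᶜ) = 0 := by
          rw [lintegral_congr_ae (g := fun _ => 0)]
          · simp
          · filter_upwards [h5] with x hx
            simp [hx]
        rw [this, add_zero]
      have h6 := (ENNReal.pow_right_strictMono two_ne_zero).injective this
      rw [h6]
      exact h3.2

theorem integral_mul_dirichletRestrict {μ : Measure (Eu N)} {Ω : Set (Eu N)}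
    (hΩ : MeasurableSet Ω) {u φ : Eu N → ℝ} (hu : MemLp u 2 μ) (hφ : MemLp φ 2 μ)
    (h : VanishesQE Ωᶜ u) :
    ∫ x, u x * φ x ∂(dirichletRestrict μ Ω) = ∫ x, u x * φ x ∂μ := by
  have h5 : (fun x => u x * φ x) =ᵐ[inftyMeasure Ωᶜ] fun _ => 0 := by
    filter_upwards [h.ae_inftyMeasure hΩ.compl] with x hx
    simp [hx]
  have i1 : Integrable (fun x => u x * φ x) μ := hu.integrable_mul hφ
  rw [dirichletRestrict, integral_add_measure i1
    ((integrable_zero _ _ _).congr h5.symm), integral_congr_ae h5]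
  simp

/-! ### The Hilbert space `H¹_μ` -/

/-- The ambient Hilbert space of `H¹_μ`. -/
abbrev H1muPair (μ : Measure (Eu N)) : Type := WithLp 2 (H1Pair N × Lp ℝ 2 μ)

/-- `k` consists of the classes of `u`, its weak gradient, and `u` modulo `μ`. -/
def IsRep (μ : Measure (Eu N)) (u : Eu N → ℝ) (k : H1muPair μ) : Prop :=
  QuasiContinuous u ∧ IsH1Rep u k.fst ∧ u =ᵐ[μ] k.snd

theorem MemH1mu.exists_isRep {μ : Measure (Eu N)} {u : Eu N → ℝ} (h : MemH1mu μ u) :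
    ∃ k, IsRep μ u k := by
  obtain ⟨h1, h2, h3⟩ := h
  obtain ⟨p, hp⟩ := h1.exists_isH1Rep
  exact ⟨WithLp.toLp 2 (p, h3.toLp u), h2, hp, h3.coeFn_toLp.symm⟩

namespace IsRep

variable {μ : Measure (Eu N)} {u v : Eu N → ℝ} {k l : H1muPair μ}

theorem memLp_mu (h : IsRep μ u k) : MemLp u 2 μ := (Lp.memLp k.snd).ae_eq h.2.2.symm

theorem memLp (h : IsRep μ u k) : MemLp u 2 volume := h.2.1.memLp

theorem memH1mu (h : IsRep μ u k) : MemH1mu μ u := ⟨h.2.1.memH1, h.1, h.memLp_mu⟩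

theorem add (h : IsRep μ u k) (h' : IsRep μ v l) : IsRep μ (u + v) (k + l) := by
  refine ⟨h.1.add h'.1, h.2.1.add h'.2.1, ?_⟩
  filter_upwards [h.2.2, h'.2.2, Lp.coeFn_add k.snd l.snd] with x h1 h2 h3
  rw [WithLp.add_snd, h3]
  simp [h1, h2]

theorem smul (h : IsRep μ u k) (c : ℝ) : IsRep μ (c • u) (c • k) := by
  refine ⟨h.1.smul c, h.2.1.smul c, ?_⟩
  filter_upwards [h.2.2, Lp.coeFn_smul c k.snd] with x h1 h3
  rw [WithLp.smul_snd, h3]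
  simp [h1]

theorem sub (h : IsRep μ u k) (h' : IsRep μ v l) : IsRep μ (u - v) (k - l) := by
  simpa [sub_eq_add_neg] using h.add (h'.smul (-1))

theorem unique (h : IsRep μ u k) (h' : IsRep μ u l) : k = l :=
  WithLp.ofLp_injective 2 (Prod.ext (h.2.1.unique h'.2.1) (Lp.ext (h.2.2.symm.trans h'.2.2)))

theorem norm_sq (k : H1muPair μ) :
    ‖k‖ ^ 2 = ‖k.fst.fst‖ ^ 2 + ‖k.fst.snd‖ ^ 2 + ‖k.snd‖ ^ 2 := by
  rw [WithLp.prod_norm_sq_eq_of_L2, WithLp.prod_norm_sq_eq_of_L2]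

/-- The three components are bounded separately because the truncation argument in
`IsTorsion.ae_mem_Icc` treats the `L²` part apart from the other two. -/
theorem exists_comp_contraction (h : IsRep μ u k) {T : ℝ → ℝ} (hT : LipschitzWith 1 T)
    (hT0 : T 0 = 0) :
    ∃ l, IsRep μ (T ∘ u) l ∧ ‖l.fst.fst‖ ≤ ‖k.fst.fst‖ ∧ ‖l.fst.snd‖ ≤ ‖k.fst.snd‖ ∧
      ‖l.snd‖ ≤ ‖k.snd‖ := by
  obtain ⟨q, hq, h1, h2⟩ := h.2.1.exists_comp_contraction hT hT0
  have hTu : MemLp (T ∘ u) 2 μ := hT.comp_memLp hT0 h.memLp_mu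
  refine ⟨WithLp.toLp 2 (q, hTu.toLp _), ⟨h.1.comp_continuous hT.continuous, hq,
    hTu.coeFn_toLp.symm⟩, h1, h2, ?_⟩
  refine Lp.norm_le_norm_of_ae_le ?_
  filter_upwards [hTu.coeFn_toLp, h.2.2] with x h1 h2
  rw [show (WithLp.toLp 2 (q, hTu.toLp (T ∘ u))).snd = hTu.toLp (T ∘ u) from rfl, h1, ← h2]
  simpa [hT0] using hT.norm_sub_le (u x) 0

theorem exists_abs (h : IsRep μ u k) : ∃ l, IsRep μ (fun x => |u x|) l ∧ ‖l‖ ≤ ‖k‖ := by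
  obtain ⟨l, hl, h1, h2, h3⟩ := h.exists_comp_contraction (T := fun t => |t|)
    (.of_dist_le_mul fun a b => by simpa [Real.dist_eq] using abs_abs_sub_abs_le a b) (by simp)
  refine ⟨l, hl, ?_⟩
  refine (sq_le_sq₀ (norm_nonneg _) (norm_nonneg _)).1 ?_
  rw [norm_sq, norm_sq]
  gcongr

theorem h1muNorm_eq (h : IsRep μ u k) : h1muNorm μ u = ‖k‖ₑ := by
  have e : h1Energy u + ∫⁻ x, ‖u x‖ₑ ^ 2 ∂μ = ‖k‖ₑ ^ 2 := by
    have e1 : ‖k‖ₑ ^ 2 = ‖k.fst‖ₑ ^ 2 + ‖k.snd‖ₑ ^ 2 := by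
      simp only [← ofReal_norm, ← ENNReal.ofReal_pow (norm_nonneg _)]
      rw [WithLp.prod_norm_sq_eq_of_L2, ENNReal.ofReal_add (by positivity) (by positivity)]
    rw [e1, h.2.1.h1Energy_eq, Lp.enorm_def, ← eLpNorm_two_sq, eLpNorm_congr_ae h.2.2]
  rw [h1muNorm, e, ← ENNReal.rpow_natCast, ← ENNReal.rpow_mul]
  norm_num

theorem inner_eq (h : IsRep μ u k) (h' : IsRep μ v l) :
    ⟪k, l⟫ = (∫ x, (⟪weakGrad u x, weakGrad v x⟫ + u x * v x)) + ∫ x, u x * v x ∂μ := by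
  have i1 : Integrable (fun x => ⟪k.fst.snd x, l.fst.snd x⟫) volume := L2.integrable_inner _ _
  have i2 : Integrable (fun x => u x * v x) volume := h.memLp.integrable_mul h'.memLp
  have e1 : ∫ x, (⟪weakGrad u x, weakGrad v x⟫ + u x * v x)
      = (∫ x, ⟪k.fst.snd x, l.fst.snd x⟫) + ∫ x, u x * v x := by
    rw [← integral_add i1 i2]
    refine integral_congr_ae ?_
    filter_upwards [h.2.1.weakGrad_ae_eq, h'.2.1.weakGrad_ae_eq] with x h1 h2
    rw [h1, h2]
  have e2 : ⟪k.fst.fst, l.fst.fst⟫ = ∫ x, u x * v x := by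
    rw [L2.inner_def]
    refine integral_congr_ae ?_
    filter_upwards [h.2.1.1, h'.2.1.1] with x h1 h2
    rw [h1, h2]
    exact mul_comm _ _
  have e3 : ⟪k.snd, l.snd⟫ = ∫ x, u x * v x ∂μ := by
    rw [L2.inner_def]
    refine integral_congr_ae ?_
    filter_upwards [h.2.2, h'.2.2] with x h1 h2
    rw [h1, h2]
    exact mul_comm _ _
  rw [e1, ← e2, ← e3, ← L2.inner_def, add_comm ⟪k.fst.snd, l.fst.snd⟫]
  rfl

end IsRep

theorem isRep_zero (μ : Measure (Eu N)) : IsRep μ (0 : Eu N → ℝ) 0 :=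
  ⟨quasiContinuous_of_continuous continuous_const, isH1Rep_zero, (Lp.coeFn_zero _ _ _).symm⟩

/-- The elements of `H¹_μ` that vanish quasi-everywhere on `S`. -/
def vanishingSpace (μ : Measure (Eu N)) (S : Set (Eu N)) : Submodule ℝ (H1muPair μ) where
  carrier := {k | ∃ u, IsRep μ u k ∧ VanishesQE S u}
  zero_mem' := ⟨0, isRep_zero μ, by simp [VanishesQE, cap_empty]⟩
  add_mem' := by
    rintro k l ⟨u, hu, hu'⟩ ⟨v, hv, hv'⟩
    exact ⟨u + v, hu.add hv, hu'.of_imp₂ hv' fun x h1 h2 => by simp [h1, h2]⟩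
  smul_mem' := by
    rintro c k ⟨u, hu, hu'⟩
    exact ⟨c • u, hu.smul c, hu'.of_imp fun x h1 => by simp [h1]⟩

theorem ae_eq_of_tendsto_Lp {α : Type*} [MeasurableSpace α] {μ : Measure α}
    {f : ℕ → Lp ℝ 2 μ} {a : Lp ℝ 2 μ} (hf : Tendsto f atTop (𝓝 a)) {v : α → ℝ}
    (hv : ∀ᵐ x ∂μ, Tendsto (fun n => f n x) atTop (𝓝 (v x))) : v =ᵐ[μ] a := by
  obtain ⟨ns, hns, h⟩ := (tendstoInMeasure_of_tendsto_Lp hf).exists_seq_tendsto_ae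
  filter_upwards [hv, h] with x h1 h2
  exact tendsto_nhds_unique (h1.comp hns.tendsto_atTop) h2

/-- A fast subsequence converges q.e. to a quasi-continuous function. As `μ` is capacitary, this is
also convergence `μ`-a.e., which identifies all three components of the limit; vanishing on `S`
survives because countable unions of sets of capacity zero have capacity zero. -/
theorem isClosed_vanishingSpace {μ : Measure (Eu N)} (hμ : IsCapacitary μ) (S : Set (Eu N)) :
    IsClosed (vanishingSpace μ S : Set (H1muPair μ)) := by
  refine IsSeqClosed.isClosed fun k a hk hlim => ?_
  -- The factor `1/2` leaves room for the triangle inequality to give consecutive distances at most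
  -- `4⁻ⁿ`.
  have hsub : ∃ φ : ℕ → ℕ, StrictMono φ ∧ ∀ n, ‖k (φ n) - a‖ < (1 / 4) ^ n / 2 := by
    refine extraction_forall_of_eventually (P := fun n m => ‖k m - a‖ < (1 / 4) ^ n / 2) fun n => ?_
    have := Metric.tendsto_atTop.1 hlim ((1 / 4) ^ n / 2) (by positivity)
    simpa only [dist_eq_norm, eventually_atTop] using this
  obtain ⟨φ, hφ, hφa⟩ := hsub
  choose u hu hvan using fun n => hk (φ n)
  have hstep : ∀ n, ‖(k (φ (n + 1))).fst - (k (φ n)).fst‖ ≤ (1 / 4) ^ n := by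
    intro n
    have h1 := hφa n
    have h2 := hφa (n + 1)
    have h3 : ((1 : ℝ) / 4) ^ (n + 1) ≤ (1 / 4) ^ n :=
      pow_le_pow_of_le_one (by norm_num) (by norm_num) n.le_succ
    calc ‖(k (φ (n + 1))).fst - (k (φ n)).fst‖ ≤ ‖k (φ (n + 1)) - k (φ n)‖ :=
          WithLp.norm_fst_le _ (k (φ (n + 1)) - k (φ n))
      _ ≤ ‖k (φ (n + 1)) - a‖ + ‖k (φ n) - a‖ := by
          rw [← sub_sub_sub_cancel_right _ _ a]
          exact norm_sub_le _ _
      _ ≤ (1 / 4) ^ n := by linarith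
  obtain ⟨v, hv, hcap⟩ := exists_quasiContinuous_limit (fun n => (hu n).2.1) (fun n => (hu n).1)
    hstep
  have hl := hlim.comp hφ.tendsto_atTop
  have hl1 : Tendsto (fun n => (k (φ n)).fst.fst) atTop (𝓝 a.fst.fst) :=
    ((WithLp.fstL 2 ℝ _ _).continuous.tendsto a.fst).comp
      (((WithLp.fstL 2 ℝ _ _).continuous.tendsto a).comp hl)
  have hl2 : Tendsto (fun n => (k (φ n)).snd) atTop (𝓝 a.snd) :=
    ((WithLp.sndL 2 ℝ _ _).continuous.tendsto a).comp hl
  have hl0 : Tendsto (fun n => (k (φ n)).fst) atTop (𝓝 a.fst) :=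
    ((WithLp.fstL 2 ℝ _ _).continuous.tendsto a).comp hl
  have hve : v =ᵐ[volume] a.fst.fst := by
    refine ae_eq_of_tendsto_Lp hl1 ?_
    filter_upwards [ae_of_cap_eq_zero hcap, ae_all_iff.2 fun n => (hu n).2.1.1] with x h1 h2
    simpa only [h2] using h1
  refine ⟨v, ⟨hv, ⟨hve, ?_⟩, ?_⟩, ?_⟩
  · have := isClosed_setOf_isWeakGrad_pair.mem_of_tendsto hl0
      (.of_forall fun n => (hu n).2.1.2.congr (hu n).2.1.1 ae_eq_rfl)
    exact this.congr hve.symm ae_eq_rfl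
  · refine ae_eq_of_tendsto_Lp hl2 ?_
    filter_upwards [(hμ _ hcap : ∀ᵐ x ∂μ, Tendsto (fun n => u n x) atTop (𝓝 (v x))),
      ae_all_iff.2 fun n => (hu n).2.2] with x h1 h2
    simpa only [h2] using h1
  · refine cap_eq_zero_of_subset ?_ (cap_union_eq_zero hcap (cap_iUnion_eq_zero hvan))
    rintro x ⟨hx, hxS⟩
    by_contra hcon
    simp only [Set.mem_union, Set.mem_iUnion, Set.mem_ofPred_eq, not_or, not_not, Set.mem_inter_iff,
      not_exists, not_and, not_imp_not] at hcon
    have h0 : ∀ n, u n x = 0 := fun n => hcon.2 n hxS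
    have h1 := hcon.1
    simp only [h0] at h1
    exact hx (tendsto_nhds_unique h1 tendsto_const_nhds)

/-! ### Weak solutions -/

/-- `u`, with classes `k`, solves `-Δu + u + μu = 1` among the functions vanishing on `S`. -/
structure IsTorsion (μ : Measure (Eu N)) (S : Set (Eu N)) (u : Eu N → ℝ) (k : H1muPair μ) :
    Prop where
  rep : IsRep μ u k
  vanishes : VanishesQE S u
  integrable : ∀ φ l, IsRep μ φ l → VanishesQE S φ → Integrable φ volume
  inner_eq : ∀ φ l, IsRep μ φ l → VanishesQE S φ → ⟪k, l⟫ = ∫ x, φ x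

theorem isWeakSolution_dirichletRestrict_iff {μ : Measure (Eu N)} {Ω : Set (Eu N)}
    (hΩ : MeasurableSet Ω) {u : Eu N → ℝ} :
    IsWeakSolution (dirichletRestrict μ Ω) (fun _ => 1) u ↔ ∃ k, IsTorsion μ Ωᶜ u k := by
  constructor
  · rintro ⟨hu, h⟩
    obtain ⟨hu1, hu2⟩ := (memH1mu_dirichletRestrict_iff hΩ).1 hu
    obtain ⟨k, hk⟩ := hu1.exists_isRep
    refine ⟨k, hk, hu2, fun φ l hl hφ => ?_, fun φ l hl hφ => ?_⟩
    · simpa using (h φ ((memH1mu_dirichletRestrict_iff hΩ).2 ⟨hl.memH1mu, hφ⟩)).1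
    · have := (h φ ((memH1mu_dirichletRestrict_iff hΩ).2 ⟨hl.memH1mu, hφ⟩)).2
      rw [integral_mul_dirichletRestrict hΩ hk.memLp_mu hl.memLp_mu hu2, ← hk.inner_eq hl] at this
      simpa using this
  · rintro ⟨k, hk⟩
    refine ⟨(memH1mu_dirichletRestrict_iff hΩ).2 ⟨hk.rep.memH1mu, hk.vanishes⟩, fun φ hφ => ?_⟩
    obtain ⟨hφ1, hφ2⟩ := (memH1mu_dirichletRestrict_iff hΩ).1 hφ
    obtain ⟨l, hl⟩ := hφ1.exists_isRep
    refine ⟨by simpa using hk.integrable φ l hl hφ2, ?_⟩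
    rw [integral_mul_dirichletRestrict hΩ hk.rep.memLp_mu hl.memLp_mu hk.vanishes,
      ← hk.rep.inner_eq hl]
    simpa using hk.inner_eq φ l hl hφ2

/-- For `φ` vanishing off `Ω`, `∫ φ` is the inner product with the vector `(1_Ω, 0, 0)`, where
finite volume puts `1_Ω` in `L²`. The solution is the projection of this vector onto the closed
subspace. -/
theorem exists_isTorsion {μ : Measure (Eu N)} (hμ : IsCapacitary μ) {Ω : Set (Eu N)}
    (hΩ : MeasurableSet Ω) (hfin : volume Ω ≠ ⊤) : ∃ u k, IsTorsion μ Ωᶜ u k := by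
  set K := vanishingSpace μ Ωᶜ
  have : CompleteSpace K := (isClosed_vanishingSpace hμ _).completeSpace_coe
  set c : Lp ℝ 2 (volume : Measure (Eu N)) := indicatorConstLp 2 hΩ hfin 1 with hc
  set A : H1muPair μ := WithLp.toLp 2 (WithLp.toLp 2 (c, 0), 0) with hA
  obtain ⟨u, hu, hvan⟩ : K.starProjection A ∈ K := K.starProjection_apply_mem A
  have hφ : ∀ φ l, IsRep μ φ l → VanishesQE Ωᶜ φ →
      (fun x => c x * φ x) =ᵐ[volume] φ := by
    intro φ l hl hv
    filter_upwards [hv.ae_volume, indicatorConstLp_coeFn (p := 2) (hs := hΩ) (hμs := hfin)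
      (c := (1 : ℝ))] with x h1 h2
    rw [hc, h2]
    by_cases hx : x ∈ Ω
    · simp [hx]
    · simp [hx, h1 hx]
  refine ⟨u, _, hu, hvan, fun φ l hl hv => ?_, fun φ l hl hv => ?_⟩
  · exact ((Lp.memLp c).integrable_mul hl.memLp).congr (hφ φ l hl hv)
  · have h1 := K.starProjection_inner_eq_zero A l ⟨φ, hl, hv⟩
    rw [inner_sub_left, sub_eq_zero] at h1
    rw [← h1, hA]
    simp only [WithLp.prod_inner_apply, inner_zero_left, add_zero]
    rw [L2.inner_def, ← integral_congr_ae (hφ φ l hl hv)]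
    refine integral_congr_ae ?_
    filter_upwards [hl.2.1.1] with x hx
    simp [hx, mul_comm]

variable {μ : Measure (Eu N)}

theorem IsRep.norm_fst_sq {u : Eu N → ℝ} {k : H1muPair μ} (h : IsRep μ u k) :
    ‖k.fst.fst‖ ^ 2 = ∫ x, u x ^ 2 := by
  rw [← real_inner_self_eq_norm_sq, L2.inner_def]
  refine integral_congr_ae ?_
  filter_upwards [h.2.1.1] with x hx
  rw [hx, real_inner_self_eq_norm_sq, Real.norm_eq_abs, sq_abs]

namespace IsTorsion

variable {S S' : Set (Eu N)} {u v : Eu N → ℝ} {k l : H1muPair μ}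

theorem norm_sq_eq (h : IsTorsion μ S u k) : ‖k‖ ^ 2 = ∫ x, u x := by
  rw [← real_inner_self_eq_norm_sq, h.inner_eq u k h.rep h.vanishes]

theorem integrable_self (h : IsTorsion μ S u k) : Integrable u volume :=
  h.integrable u k h.rep h.vanishes

/-- Torsion functions take values in `[0, 1]`. -/
theorem ae_mem_Icc (h : IsTorsion μ S u k) : ∀ᵐ x, u x ∈ Set.Icc (0 : ℝ) 1 := by
  set T : ℝ → ℝ := fun t => min |t| 1 with hTdef
  have hT : LipschitzWith 1 T := by
    have h1 : LipschitzWith 1 (fun t : ℝ => |t|) :=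
      .of_dist_le_mul fun a b => by simpa [Real.dist_eq] using abs_abs_sub_abs_le a b
    exact h1.min_const 1
  obtain ⟨l, hl, hl1, hl2, hl3⟩ := h.rep.exists_comp_contraction hT (by simp [hTdef])
  have hv : VanishesQE S (T ∘ u) := h.vanishes.of_imp fun x hx => by simp [hTdef, hx]
  have i1 := h.integrable_self
  have i2 := h.integrable _ l hl hv
  have i3 := h.rep.memLp.integrable_sq
  have i4 := hl.memLp.integrable_sq
  have hin := h.inner_eq _ l hl hv
  -- Pointwise, `t² - 2t = (t - 1)² - 1` does not increase when `t` is replaced by `min |t| 1`.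
  have hJ : (∫ x, (T ∘ u) x ^ 2) - 2 * ∫ x, (T ∘ u) x
      ≤ (∫ x, u x ^ 2) - 2 * ∫ x, u x := by
    rw [← integral_const_mul, ← integral_const_mul, ← integral_sub i4 (i2.const_mul 2),
      ← integral_sub i3 (i1.const_mul 2)]
    refine integral_mono (i4.sub (i2.const_mul 2)) (i3.sub (i1.const_mul 2)) fun x => ?_
    simp only [hTdef, Function.comp_apply]
    rcases le_total |u x| 1 with h1 | h1
    · rw [min_eq_left h1, sq_abs]
      linarith [le_abs_self (u x)]
    · rw [min_eq_right h1]
      nlinarith [sq_nonneg (u x - 1)]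
  rw [← hl.norm_fst_sq, ← h.rep.norm_fst_sq, ← h.norm_sq_eq, ← hin] at hJ
  -- Adding the contraction of the gradient and `μ` parts gives `‖l‖² - 2⟪k, l⟫ ≤ ‖k‖² - 2‖k‖²`: the
  -- truncation does at least as well as the unique minimizer `k` of the energy.
  have hzero : ‖l - k‖ ^ 2 ≤ 0 := by
    rw [norm_sub_sq_real, real_inner_comm]
    have e1 := IsRep.norm_sq k
    have e2 := IsRep.norm_sq l
    have : ‖l.fst.snd‖ ^ 2 ≤ ‖k.fst.snd‖ ^ 2 := by gcongr
    have : ‖l.snd‖ ^ 2 ≤ ‖k.snd‖ ^ 2 := by gcongr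
    linarith
  have hlk : l = k := by
    have : ‖l - k‖ = 0 := by nlinarith [norm_nonneg (l - k)]
    exact sub_eq_zero.1 (norm_eq_zero.1 this)
  subst hlk
  filter_upwards [h.rep.2.1.1, hl.2.1.1] with x h1 h2
  have h3 : T (u x) = u x := h2.trans h1.symm
  rw [← h3]
  exact ⟨le_min (abs_nonneg _) zero_le_one, min_le_right _ _⟩

/-- Quasi-continuity upgrades `u ≥ 0` from a.e. to q.e., as needed to verify the boundary condition
of the test function in `ae_le`. -/
theorem cap_neg_eq_zero (h : IsTorsion μ S u k) : cap {x | |u x| - u x ≠ 0} = 0 := by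
  refine QuasiContinuous.cap_ne_zero_eq_zero (f := fun x => |u x| - u x)
    (h.rep.1.comp_continuous (T := fun t => |t| - t) (by fun_prop)) ?_
  filter_upwards [h.ae_mem_Icc] with x hx
  simp [abs_of_nonneg hx.1]

/-- Comparison principle. -/
theorem ae_le (h : IsTorsion μ S u k) (h' : IsTorsion μ S' v l) (hS : S' ⊆ S) :
    u ≤ᵐ[volume] v := by
  have hd := h.rep.sub h'.rep
  obtain ⟨m, hm, hml⟩ := hd.exists_abs
  have hp := hm.add hd
  -- The test function is `2(u - v)⁺`; q.e. on `S` it vanishes, since there `u = 0` and `v ≥ 0`.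
  have hvan : VanishesQE S ((fun x => |(u - v) x|) + (u - v)) := by
    refine cap_eq_zero_of_subset (fun x hx => ?_)
      (cap_union_eq_zero h.vanishes h'.cap_neg_eq_zero)
    by_contra hcon
    simp only [Set.mem_union, Set.mem_inter_iff, Set.mem_ofPred_eq, not_or, not_and, not_not] at hcon
    have hu0 : u x = 0 := by
      by_contra h0
      exact hcon.1 h0 hx.2
    have hv0 : |v x| = v x := sub_eq_zero.1 hcon.2
    refine hx.1 ?_
    simp [hu0, hv0]
  have e1 := h.inner_eq _ _ hp hvan
  have e2 := h'.inner_eq _ _ hp (hvan.mono hS)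
  have e3 : ⟪k - l, m + (k - l)⟫ = 0 := by
    rw [inner_sub_left, e1, e2, sub_self]
  -- With `⟪k - l, m + (k - l)⟫ = 0` and `‖m‖ ≤ ‖k - l‖`, the square expands to at most `2‖k - l‖² +
  -- 2⟪m, k - l⟫ = 0`.
  have hz : ‖m + (k - l)‖ ^ 2 ≤ 0 := by
    rw [inner_add_right, real_inner_self_eq_norm_sq, real_inner_comm] at e3
    rw [norm_add_sq_real]
    have : ‖m‖ ^ 2 ≤ ‖k - l‖ ^ 2 := by gcongr
    linarith
  have hz' : m + (k - l) = 0 := by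
    have : ‖m + (k - l)‖ = 0 := by nlinarith [norm_nonneg (m + (k - l))]
    exact norm_eq_zero.1 this
  rw [hz'] at hp
  filter_upwards [hp.2.1.1, Lp.coeFn_zero ℝ 2 (volume : Measure (Eu N))] with x h1 h2
  have h3 : |u x - v x| + (u x - v x) = 0 := h1.trans h2
  linarith [abs_nonneg (u x - v x)]

end IsTorsion

/-! ### Existence and monotonicity of the limit -/

theorem isLimitSolution_iff {w : Eu N → ℝ} : IsLimitSolution μ w ↔ ∃ u : ℝ → Eu N → ℝ,
    (∀ R : ℝ, 0 < R → ∃ k, IsTorsion μ (Metric.ball 0 R)ᶜ (u R) k) ∧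
    ∀ r : ℕ → ℝ, Tendsto r atTop atTop →
      ∀ᵐ x, Tendsto (fun n => u (r n) x) atTop (𝓝 (w x)) := by
  simp only [IsLimitSolution, isWeakSolution_dirichletRestrict_iff Metric.isOpen_ball.measurableSet]

/-- The limit function `w_μ` exists. -/
theorem exists_isLimitSolution (hμ : IsCapacitary μ) : ∃ w : Eu N → ℝ, IsLimitSolution μ w := by
  have hex : ∀ R : ℝ, ∃ u k, IsTorsion μ (Metric.ball 0 R)ᶜ u k := fun R =>
    exists_isTorsion hμ Metric.isOpen_ball.measurableSet measure_ball_lt_top.ne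
  choose u k hu using hex
  have hmono : ∀ R R' : ℝ, R ≤ R' → u R ≤ᵐ[volume] u R' := fun R R' hRR' =>
    (hu R).ae_le (hu R') (Set.compl_subset_compl.2 (Metric.ball_subset_ball hRR'))
  refine ⟨fun x => ⨆ i : ℕ, u i x, isLimitSolution_iff.2 ⟨u, fun R _ => ⟨k R, hu R⟩, ?_⟩⟩
  intro r hr
  -- Comparing only integer radii with the terms of `r` keeps the exceptional sets countable in
  -- number, so one null set serves for the whole sequence.
  have h1 : ∀ᵐ x, ∀ i n : ℕ, ((i : ℝ) ≤ r n → u i x ≤ u (r n) x) ∧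
      (r n ≤ i → u (r n) x ≤ u i x) := by
    refine ae_all_iff.2 fun i => ae_all_iff.2 fun n => ?_
    rcases le_total (i : ℝ) (r n) with h | h
    · by_cases h' : r n ≤ i
      · have : (i : ℝ) = r n := le_antisymm h h'
        simp [this]
      · filter_upwards [hmono _ _ h] with x hx
        exact ⟨fun _ => hx, fun h'' => absurd h'' h'⟩
    · by_cases h' : (i : ℝ) ≤ r n
      · have : (i : ℝ) = r n := le_antisymm h' h
        simp [this]
      · filter_upwards [hmono _ _ h] with x hx
        exact ⟨fun h'' => absurd h'' h', fun _ => hx⟩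
  filter_upwards [h1, ae_all_iff.2 fun i : ℕ => (hu i).ae_mem_Icc] with x h1 h2
  have hbdd : BddAbove (Set.range fun i : ℕ => u i x) := ⟨1, by
    rintro _ ⟨i, rfl⟩
    exact (h2 i).2⟩
  refine tendsto_order.2 ⟨fun a ha => ?_, fun a ha => ?_⟩
  · obtain ⟨i, hi⟩ := exists_lt_of_lt_ciSup ha
    filter_upwards [hr.eventually_ge_atTop (i : ℝ)] with n hn
    exact hi.trans_le ((h1 i n).1 hn)
  · refine .of_forall fun n => ?_
    obtain ⟨i, hi⟩ := exists_nat_ge (r n)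
    exact (((h1 i n).2 hi).trans (le_ciSup hbdd i)).trans_lt ha

theorem IsLimitSolution.exists_torsion_le {w : Eu N → ℝ} (hw : IsLimitSolution μ w) {R : ℝ}
    (hR : 0 < R) : ∃ u k, IsTorsion μ (Metric.ball 0 R)ᶜ u k ∧ u ≤ᵐ[volume] w := by
  obtain ⟨u, hu, hlim⟩ := isLimitSolution_iff.1 hw
  obtain ⟨k, hk⟩ := hu R hR
  refine ⟨u R, k, hk, ?_⟩
  have h1 := hlim (fun n => R + n)
    (tendsto_atTop_add_const_left _ _ tendsto_natCast_atTop_atTop)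
  have h2 : ∀ᵐ x, ∀ n : ℕ, u R x ≤ u (R + n) x := by
    refine ae_all_iff.2 fun n => ?_
    obtain ⟨k', hk'⟩ := hu (R + n) (by positivity)
    exact hk.ae_le hk' (Set.compl_subset_compl.2 (Metric.ball_subset_ball (by simp)))
  filter_upwards [h1, h2] with x h1 h2
  exact ge_of_tendsto' h1 h2

/-! ### Integrability of `w_μ` and the continuous embedding -/

theorem lintegral_enorm_le_of_tendsto {α : Type*} [MeasurableSpace α] {ν : Measure α}
    {u : ℕ → α → ℝ} {w : α → ℝ} (hu : ∀ n, AEStronglyMeasurable (u n) ν)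
    (h : ∀ᵐ x ∂ν, Tendsto (fun n => u n x) atTop (𝓝 (w x))) {C : ℝ≥0∞}
    (hC : ∀ n, eLpNorm (u n) 1 ν ≤ C) : eLpNorm w 1 ν ≤ C := by
  refine (Lp.eLpNorm_lim_le_liminf_eLpNorm hu w h).trans ?_
  refine liminf_le_of_le (by isBoundedDefault) fun b hb => ?_
  obtain ⟨n, hn⟩ := hb.exists
  exact hn.trans (hC n)

theorem eLpNorm_one_eq_ofReal {α : Type*} [MeasurableSpace α] {ν : Measure α} {f : α → ℝ}
    (hf : Integrable f ν) : eLpNorm f 1 ν = ENNReal.ofReal (∫ x, |f x| ∂ν) := by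
  rw [eLpNorm_one_eq_lintegral_enorm, ← ofReal_integral_norm_eq_lintegral_enorm hf]
  rfl

/-- A continuous embedding in `L¹` forces `w_μ` to be integrable. -/
theorem memLp_one_of_embedsContinuouslyL1 {w : Eu N → ℝ} (hw : IsLimitSolution μ w)
    (h : EmbedsContinuouslyL1 μ) : MemLp w 1 volume := by
  obtain ⟨C, hC⟩ := h
  obtain ⟨u, hu, hlim⟩ := isLimitSolution_iff.1 hw
  choose k hk using fun n : ℕ => hu ((n : ℝ) + 1) (by positivity)
  have hl := hlim (fun n : ℕ => (n : ℝ) + 1)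
    (tendsto_atTop_add_const_right _ _ tendsto_natCast_atTop_atTop)
  have hm : ∀ n : ℕ, AEStronglyMeasurable (u ((n : ℝ) + 1)) volume := fun n =>
    (hk n).integrable_self.1
  have hb : ∀ n : ℕ, eLpNorm (u ((n : ℝ) + 1)) 1 volume ≤ ENNReal.ofReal (C * C) := by
    intro n
    have h1 := (hC _ (hk n).rep.memH1mu).2
    rw [(hk n).rep.h1muNorm_eq, eLpNorm_one_eq_ofReal (hk n).integrable_self, ← ofReal_norm,
      ← ENNReal.ofReal_coe_nnreal, ← ENNReal.ofReal_mul C.coe_nonneg,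
      ENNReal.ofReal_le_ofReal_iff (by positivity)] at h1
    have h2 : ∫ x, |u ((n : ℝ) + 1) x| = ‖k n‖ ^ 2 := by
      rw [(hk n).norm_sq_eq]
      refine integral_congr_ae ?_
      filter_upwards [(hk n).ae_mem_Icc] with x hx
      exact abs_of_nonneg hx.1
    rw [h2] at h1
    -- The embedding applied to the solution reads `‖k n‖² ≤ C ‖k n‖`.
    have h3 : ‖k n‖ ≤ C := by
      by_contra! hlt
      nlinarith [C.coe_nonneg, norm_nonneg (k n)]
    rw [eLpNorm_one_eq_ofReal (hk n).integrable_self, h2]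
    refine ENNReal.ofReal_le_ofReal ?_
    nlinarith [norm_nonneg (k n), C.coe_nonneg]
  exact ⟨aestronglyMeasurable_of_tendsto_ae _ hm hl,
    (lintegral_enorm_le_of_tendsto hm hl hb).trans_lt ENNReal.ofReal_lt_top⟩

theorem memLp_mul_of_bounded {α F : Type*} [MeasurableSpace α] [NormedAddCommGroup F]
    [NormedSpace ℝ F] {ν : Measure α} {χ : α → ℝ} {f : α → F} (hχ : AEStronglyMeasurable χ ν)
    {p : ℝ≥0∞} (hf : MemLp f p ν) {c : ℝ} (hc : ∀ x, |χ x| ≤ c) :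
    MemLp (fun x => χ x • f x) p ν := by
  refine hf.of_le_mul (c := c) (hχ.smul hf.1) (.of_forall fun x => ?_)
  rw [norm_smul]
  exact mul_le_mul_of_nonneg_right (hc x) (norm_nonneg _)

/-- Multiplication by smooth cutoff functions in `H¹_μ`. -/
theorem IsRep.exists_mul {u χ : Eu N → ℝ} {k : H1muPair μ} (h : IsRep μ u k)
    (hχ : ContDiff ℝ ∞ χ) (hχ1 : ∀ x, |χ x| ≤ 1) {M : ℝ} (hM : ∀ x, ‖fderiv ℝ χ x‖ ≤ M) :
    ∃ l : H1muPair μ, IsRep μ (fun x => χ x * u x) l ∧ ‖l‖ ≤ (3 + M) * ‖k‖ ∧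
      ∀ A : Set (Eu N), (∀ x ∈ A, χ x = 0 ∧ fderiv ℝ χ x = 0) →
        (∀ᵐ x, x ∈ A → l.fst.fst x = 0) ∧ (∀ᵐ x, x ∈ A → l.fst.snd x = 0) ∧
        (∀ᵐ x ∂μ, x ∈ A → l.snd x = 0) := by
  have hM0 : 0 ≤ M := (norm_nonneg _).trans (hM 0)
  have hgn : ∀ x, ‖gradient χ x‖ = ‖fderiv ℝ χ x‖ := fun x => by simp [gradient]
  have hgc : Continuous (gradient χ) := by
    have := hχ.continuous_fderiv (by simp)
    unfold gradient
    fun_prop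
  have m1 : MemLp (fun x => χ x * u x) 2 volume :=
    memLp_mul_of_bounded hχ.continuous.aestronglyMeasurable h.memLp hχ1
  have m3 : MemLp (fun x => χ x * u x) 2 μ :=
    memLp_mul_of_bounded hχ.continuous.aestronglyMeasurable h.memLp_mu hχ1
  have m2a : MemLp (fun x => χ x • k.fst.snd x) 2 volume :=
    memLp_mul_of_bounded hχ.continuous.aestronglyMeasurable (Lp.memLp _) hχ1
  have m2b : MemLp (fun x => u x • gradient χ x) 2 volume := by
    refine h.memLp.of_le_mul (c := M) (h.memLp.1.smul hgc.aestronglyMeasurable)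
      (.of_forall fun x => ?_)
    rw [norm_smul, hgn, mul_comm]
    exact mul_le_mul_of_nonneg_right (hM x) (norm_nonneg _)
  have m2 : MemLp (fun x => χ x • k.fst.snd x + u x • gradient χ x) 2 volume := m2a.add m2b
  have hw := h.2.1.2.mul h.memLp (Lp.memLp _) hχ m1 m2
  set l : H1muPair μ := WithLp.toLp 2 (WithLp.toLp 2 (m1.toLp _, m2.toLp _), m3.toLp _) with hl
  have e1 : l.fst.fst = m1.toLp _ := rfl
  have e2 : l.fst.snd = m2.toLp _ := rfl
  have e3 : l.snd = m3.toLp _ := rfl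
  refine ⟨l, ⟨(quasiContinuous_of_continuous hχ.continuous).mul h.1, ⟨m1.coeFn_toLp.symm,
    hw.congr ae_eq_rfl m2.coeFn_toLp.symm⟩, m3.coeFn_toLp.symm⟩, ?_, fun A hA => ⟨?_, ?_, ?_⟩⟩
  · have b1 : ‖l.fst.fst‖ ≤ ‖k.fst.fst‖ := by
      refine Lp.norm_le_norm_of_ae_le ?_
      filter_upwards [m1.coeFn_toLp, h.2.1.1] with x h1 h2
      rw [e1, h1, ← h2, norm_mul]
      exact mul_le_of_le_one_left (norm_nonneg _) (hχ1 x)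
    have b3 : ‖l.snd‖ ≤ ‖k.snd‖ := by
      refine Lp.norm_le_norm_of_ae_le ?_
      filter_upwards [m3.coeFn_toLp, h.2.2] with x h1 h2
      rw [e3, h1, ← h2, norm_mul]
      exact mul_le_of_le_one_left (norm_nonneg _) (hχ1 x)
    -- The product rule costs `1 + M` here; the two other components cost `1` each, whence the
    -- factor `3 + M`.
    have b2 : ‖l.fst.snd‖ ≤ ‖k.fst.snd‖ + M * ‖k.fst.fst‖ := by
      have : l.fst.snd = m2a.toLp _ + m2b.toLp _ := by
        rw [e2]
        rfl
      rw [this]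
      refine (norm_add_le _ _).trans (add_le_add ?_ ?_)
      · refine Lp.norm_le_norm_of_ae_le ?_
        filter_upwards [m2a.coeFn_toLp] with x h1
        rw [h1, norm_smul]
        exact mul_le_of_le_one_left (norm_nonneg _) (hχ1 x)
      · refine Lp.norm_le_mul_norm_of_ae_le_mul ?_
        filter_upwards [m2b.coeFn_toLp, h.2.1.1] with x h1 h2
        rw [h1, ← h2, norm_smul, hgn, mul_comm]
        exact mul_le_mul_of_nonneg_right (hM x) (norm_nonneg _)
    have c0 : ‖k.fst‖ ≤ ‖k‖ := WithLp.norm_fst_le _ k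
    have c1 : ‖k.fst.fst‖ ≤ ‖k‖ := (WithLp.norm_fst_le _ k.fst).trans c0
    have c2 : ‖k.fst.snd‖ ≤ ‖k‖ := (WithLp.norm_snd_le _ k.fst).trans c0
    have c3 : ‖k.snd‖ ≤ ‖k‖ := WithLp.norm_snd_le _ k
    have hsum : ‖l‖ ≤ ‖l.fst.fst‖ + ‖l.fst.snd‖ + ‖l.snd‖ := by
      refine (sq_le_sq₀ (norm_nonneg _) (by positivity)).1 ?_
      rw [IsRep.norm_sq]
      nlinarith [mul_nonneg (norm_nonneg l.fst.fst) (norm_nonneg l.fst.snd),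
        mul_nonneg (norm_nonneg l.fst.fst) (norm_nonneg l.snd),
        mul_nonneg (norm_nonneg l.fst.snd) (norm_nonneg l.snd)]
    have c4 : M * ‖k.fst.fst‖ ≤ M * ‖k‖ := by gcongr
    linarith
  · filter_upwards [m1.coeFn_toLp] with x h1 hx
    rw [e1, h1, (hA x hx).1, zero_mul]
  · filter_upwards [m2.coeFn_toLp] with x h1 hx
    rw [e2, h1, (hA x hx).1, gradient, (hA x hx).2]
    simp
  · filter_upwards [m3.coeFn_toLp] with x h1 hx
    rw [e3, h1, (hA x hx).1, zero_mul]

/-- Smooth cutoff functions at scale `n + 1`, with uniformly bounded gradients. -/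
theorem exists_cutoff (N : ℕ) : ∃ (η : ℕ → Eu N → ℝ) (M : ℝ), ∀ n, ContDiff ℝ ∞ (η n) ∧
    (∀ x, η n x ∈ Set.Icc (0 : ℝ) 1) ∧ (∀ x, ‖fderiv ℝ (η n) x‖ ≤ M) ∧
    (∀ x ∈ Metric.ball (0 : Eu N) (n + 1), η n x = 1) ∧
    (∀ x ∉ Metric.ball (0 : Eu N) (2 * (n + 1)), η n x = 0) := by
  let b : ContDiffBump (0 : Eu N) := ⟨1, 2, one_pos, one_lt_two⟩
  have hbs : ContDiff ℝ ∞ b := b.contDiff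
  obtain ⟨M, hM⟩ := (hbs.continuous_fderiv (by simp)).bounded_above_of_compact_support
    (b.hasCompactSupport.fderiv ℝ)
  refine ⟨fun n x => b (((n : ℝ) + 1)⁻¹ • x), M, fun n => ⟨?_, ?_, ?_, ?_, ?_⟩⟩
  · exact hbs.comp (contDiff_id.const_smul _)
  · exact fun x => ⟨b.nonneg, b.le_one⟩
  -- Rescaling multiplies the gradient by `1/(n + 1) ≤ 1`, so the bound for the fixed bump serves
  -- for every `n`.
  · intro x
    have h1 : HasFDerivAt (fun x : Eu N => ((n : ℝ) + 1)⁻¹ • x)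
        (((n : ℝ) + 1)⁻¹ • ContinuousLinearMap.id ℝ (Eu N)) x :=
      (((n : ℝ) + 1)⁻¹ • ContinuousLinearMap.id ℝ (Eu N)).hasFDerivAt
    have h2 := (hbs.differentiable (by simp) (((n : ℝ) + 1)⁻¹ • x)).hasFDerivAt
    have h3 : fderiv ℝ (fun x => b (((n : ℝ) + 1)⁻¹ • x)) x = _ := (h2.comp x h1).fderiv
    rw [h3, ContinuousLinearMap.comp_smul, ContinuousLinearMap.comp_id, norm_smul]
    refine (mul_le_of_le_one_left (norm_nonneg _) ?_).trans (hM _)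
    rw [norm_inv, Real.norm_eq_abs, abs_of_nonneg (by positivity)]
    exact inv_le_one_of_one_le₀ (by linarith [n.cast_nonneg (α := ℝ)])
  · intro x hx
    refine b.one_of_mem_closedBall ?_
    rw [mem_closedBall_zero_iff, norm_smul, norm_inv, Real.norm_eq_abs,
      abs_of_nonneg (by positivity), inv_mul_le_iff₀ (by positivity)]
    have := (mem_ball_zero_iff.1 hx).le
    change _ ≤ ((n : ℝ) + 1) * 1
    linarith
  · intro x hx
    refine b.zero_of_le_dist ?_
    rw [dist_zero_right, norm_smul, norm_inv, Real.norm_eq_abs,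
      abs_of_nonneg (by positivity), le_inv_mul_iff₀ (by positivity)]
    have : 2 * ((n : ℝ) + 1) ≤ ‖x‖ := by simpa using hx
    change ((n : ℝ) + 1) * 2 ≤ _
    linarith

/-- If `w_μ` is integrable, then `H¹_μ` embeds continuously in `L¹`. -/
theorem embedsContinuouslyL1_of_memLp_one {w : Eu N → ℝ} (hw : IsLimitSolution μ w)
    (h : MemLp w 1 volume) : EmbedsContinuouslyL1 μ := by
  have hwi : Integrable w volume := memLp_one_iff_integrable.1 h
  set I : ℝ := ∫ x, |w x| with hI
  have hI0 : 0 ≤ I := integral_nonneg fun x => abs_nonneg _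
  -- Testing the torsion equation with `|φ|` turns the `L¹` norm into an inner product, and `‖k‖² =
  -- ∫ u ≤ ∫ |w|`.
  have key : ∀ R : ℝ, 0 < R → ∀ φ l, IsRep μ φ l → VanishesQE (Metric.ball 0 R)ᶜ φ →
      eLpNorm φ 1 volume ≤ ENNReal.ofReal (√I * ‖l‖) := by
    intro R hR φ l hl hv
    obtain ⟨u, k, hk, huw⟩ := hw.exists_torsion_le hR
    obtain ⟨l', hl', hle⟩ := hl.exists_abs
    have hv' : VanishesQE (Metric.ball 0 R)ᶜ (fun x => |φ x|) :=
      hv.of_imp fun x hx => by simp [hx]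
    have h1 := hk.inner_eq _ l' hl' hv'
    have h2 : ‖k‖ ^ 2 ≤ I := by
      rw [hk.norm_sq_eq]
      refine integral_mono_ae hk.integrable_self hwi.abs ?_
      filter_upwards [huw] with x hx
      exact hx.trans (le_abs_self _)
    rw [eLpNorm_one_eq_ofReal (hk.integrable φ l hl hv), ← h1]
    refine ENNReal.ofReal_le_ofReal ((real_inner_le_norm _ _).trans ?_)
    gcongr
    exact Real.le_sqrt_of_sq_le h2
  obtain ⟨η, M, hη⟩ := exists_cutoff N
  have hM0 : 0 ≤ M := (norm_nonneg _).trans ((hη 0).2.2.1 0)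
  refine ⟨⟨√I * (3 + M), by positivity⟩, fun u hu => ?_⟩
  obtain ⟨k, hk⟩ := hu.exists_isRep
  have hbound : eLpNorm u 1 volume ≤ ENNReal.ofReal (√I * (3 + M) * ‖k‖) := by
    -- The cut-off functions `η n * u` satisfy `key` with a bound independent of `n` and equal `u`
    -- at each point from some `n` on.
    refine lintegral_enorm_le_of_tendsto (u := fun n x => η n x * u x) (fun n =>
      (hη n).1.continuous.aestronglyMeasurable.mul hk.memLp.1) (.of_forall fun x => ?_)
      fun n => ?_
    · refine tendsto_const_nhds.congr' ?_
      obtain ⟨m, hm⟩ := exists_nat_gt ‖x‖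
      filter_upwards [eventually_ge_atTop m] with n hn
      have : x ∈ Metric.ball (0 : Eu N) (n + 1) := by
        rw [mem_ball_zero_iff]
        have : (m : ℝ) ≤ n := by exact_mod_cast hn
        linarith
      rw [(hη n).2.2.2.1 x this, one_mul]
    · obtain ⟨l, hl, hle, -⟩ := hk.exists_mul (hη n).1
        (fun x => abs_le.2 ⟨by linarith [((hη n).2.1 x).1], ((hη n).2.1 x).2⟩) (hη n).2.2.1
      have hv : VanishesQE (Metric.ball (0 : Eu N) (2 * (n + 1)))ᶜ (fun x => η n x * u x) := by
        refine cap_eq_zero_of_subset (fun x hx => ?_) cap_empty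
        exact absurd (by simp only [(hη n).2.2.2.2 x hx.2, zero_mul]) hx.1
      refine (key _ (by positivity) _ l hl hv).trans (ENNReal.ofReal_le_ofReal ?_)
      rw [mul_assoc]
      gcongr
  refine ⟨⟨hk.memLp.1, hbound.trans_lt ENNReal.ofReal_lt_top⟩, hbound.trans_eq ?_⟩
  rw [hk.h1muNorm_eq, ← ofReal_norm, ENNReal.ofReal_mul (by positivity)]
  congr 1
  exact ENNReal.ofReal_eq_coe_nnreal _

/-! ### Local compactness -/

/-- Comparison of a function with its averages over balls of radius `ε`. -/
theorem measure_mul_lintegral_le_average {d : Lp ℝ 2 (volume : Measure (Eu N))}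
    {G : Lp (Eu N) 2 (volume : Measure (Eu N))} (h : IsWeakGrad d G) {ε : ℝ} (hε : 0 ≤ ε) (R : ℝ) :
    volume (Metric.ball (0 : Eu N) ε) * ∫⁻ x in Metric.ball (0 : Eu N) R, ‖d x‖ₑ ≤
      volume (Metric.ball (0 : Eu N) ε) *
        (ENNReal.ofReal (ε * ‖G‖) * volume (Metric.ball (0 : Eu N) R) ^ (1 / 2 : ℝ)) +
      ∫⁻ x in Metric.ball (0 : Eu N) R, ‖∫ y in Metric.ball (0 : Eu N) ε, d (x + y)‖ₑ := by
  set B := Metric.ball (0 : Eu N) ε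
  set D := Metric.ball (0 : Eu N) R
  have hB : volume B ≠ ⊤ := measure_ball_lt_top.ne
  have : IsFiniteMeasure (volume.restrict B) := isFiniteMeasure_restrict.2 hB
  have : IsFiniteMeasure (volume.restrict D) := isFiniteMeasure_restrict.2 measure_ball_lt_top.ne
  have hd : StronglyMeasurable d := Lp.stronglyMeasurable d
  have hdp : StronglyMeasurable fun z : Eu N × Eu N => d (z.1 + z.2) :=
    hd.comp_measurable (measurable_fst.add measurable_snd)
  have hsub : StronglyMeasurable fun z : Eu N × Eu N => d (z.1 + z.2) - d z.1 :=
    hdp.sub (hd.comp_measurable measurable_fst)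
  have hint : ∀ x, Integrable (fun y => d (x + y)) (volume.restrict B) := fun x =>
    (((Lp.memLp d).comp_measurePreserving (measurePreserving_add_left volume x)).restrict
      B).integrable (by norm_num)
  -- Write the constant `d x` as `d (x + y) - (d (x + y) - d x)` and integrate over `y ∈ B`; keeping
  -- the factor `volume B` avoids dividing by it.
  have hpt : ∀ x, volume B * ‖d x‖ₑ
      ≤ (∫⁻ y in B, ‖d (x + y) - d x‖ₑ) + ‖∫ y in B, d (x + y)‖ₑ := by
    intro x
    have e1 : ∫ y in B, d x = (∫ y in B, d (x + y)) - ∫ y in B, (d (x + y) - d x) := by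
      rw [integral_sub (hint x) (integrable_const _)]
      ring
    have e2 : volume B * ‖d x‖ₑ = ‖∫ y in B, d x‖ₑ := by
      rw [setIntegral_const, enorm_smul, Measure.real, Real.enorm_eq_ofReal ENNReal.toReal_nonneg,
        ENNReal.ofReal_toReal hB]
    rw [e2, e1, add_comm]
    exact enorm_sub_le.trans (add_le_add le_rfl (enorm_integral_le_lintegral_enorm _))
  -- The gradient bounds the translation difference in `L²` by `‖y‖ ‖G‖`; Hölder on `D` passes to
  -- `L¹`.
  have htr : ∀ y ∈ B, ∫⁻ x in D, ‖d (x + y) - d x‖ₑ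
      ≤ ENNReal.ofReal (ε * ‖G‖) * volume D ^ (1 / 2 : ℝ) := by
    intro y hy
    have hm : MemLp (fun x => d (x + y) - d x) 2 volume :=
      (memLp_translate (Lp.memLp d) y).sub (Lp.memLp d)
    have h1 : eLpNorm (fun x => d (x + y) - d x) 2 volume ≤ ENNReal.ofReal (ε * ‖G‖) := by
      rw [ENNReal.le_ofReal_iff_toReal_le hm.eLpNorm_ne_top (by positivity)]
      refine (h.eLpNorm_translate_sub_le (Lp.memLp d) (Lp.memLp G) y).trans ?_
      have h2 : eLpNorm (fun x => ⟪G x, y⟫) 2 volume ≤ ENNReal.ofReal ‖y‖ * eLpNorm G 2 volume :=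
        eLpNorm_le_mul_eLpNorm_of_ae_le_mul (.of_forall fun x => by
          rw [mul_comm]
          exact norm_inner_le_norm _ _) 2
      refine (ENNReal.toReal_mono (ENNReal.mul_ne_top ENNReal.ofReal_ne_top
        (Lp.eLpNorm_ne_top G)) h2).trans ?_
      rw [ENNReal.toReal_mul, ENNReal.toReal_ofReal (norm_nonneg _), ← Lp.norm_def]
      gcongr
      exact (mem_ball_zero_iff.1 hy).le
    rw [← eLpNorm_one_eq_lintegral_enorm]
    refine (eLpNorm_le_eLpNorm_mul_rpow_measure_univ (p := 1) (q := 2) (by norm_num)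
      hm.1.restrict).trans ?_
    rw [Measure.restrict_apply_univ]
    have e : (1 / (1 : ℝ≥0∞).toReal - 1 / (2 : ℝ≥0∞).toReal : ℝ) = 1 / 2 := by norm_num
    rw [e]
    gcongr
    exact (eLpNorm_mono_measure _ Measure.restrict_le_self).trans h1
  calc volume B * ∫⁻ x in D, ‖d x‖ₑ = ∫⁻ x in D, volume B * ‖d x‖ₑ :=
        (lintegral_const_mul' _ _ hB).symm
    _ ≤ ∫⁻ x in D, ((∫⁻ y in B, ‖d (x + y) - d x‖ₑ) + ‖∫ y in B, d (x + y)‖ₑ) :=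
        lintegral_mono hpt
    _ = (∫⁻ x in D, ∫⁻ y in B, ‖d (x + y) - d x‖ₑ) + ∫⁻ x in D, ‖∫ y in B, d (x + y)‖ₑ :=
        lintegral_add_left (hsub.enorm.lintegral_prod_right') _
    _ ≤ _ := by
        gcongr
        rw [lintegral_lintegral_swap (hsub.enorm.aemeasurable)]
        calc ∫⁻ y in B, ∫⁻ x in D, ‖d (x + y) - d x‖ₑ
            ≤ ∫⁻ y in B, ENNReal.ofReal (ε * ‖G‖) * volume D ^ (1 / 2 : ℝ) :=
              setLIntegral_mono measurable_const htr
          _ = _ := by rw [setLIntegral_const, mul_comm]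

/-- The closed subspace of pairs consisting of an `H¹` function and its weak gradient. -/
def h1Submodule (N : ℕ) : Submodule ℝ (H1Pair N) where
  carrier := {p | IsWeakGrad p.fst p.snd}
  zero_mem' := isH1Rep_zero.2.congr isH1Rep_zero.1 ae_eq_rfl
  add_mem' := by
    intro p q hp hq
    have h : IsH1Rep _ (p + q) := IsH1Rep.add (u := p.fst) (v := q.fst) ⟨ae_eq_rfl, hp⟩ ⟨ae_eq_rfl, hq⟩
    exact h.2.congr h.1 ae_eq_rfl
  smul_mem' := by
    intro c p hp
    have h : IsH1Rep _ (c • p) := IsH1Rep.smul (u := p.fst) ⟨ae_eq_rfl, hp⟩ c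
    exact h.2.congr h.1 ae_eq_rfl

/-- Bounded sequences of `H¹` have subsequences that converge in `L¹` on every ball. -/
theorem exists_subseq_tendsto_ball {p : ℕ → H1Pair N} {C : ℝ} (hp : ∀ n, p n ∈ h1Submodule N)
    (hC : ∀ n, ‖p n‖ ≤ C) :
    ∃ s : ℕ → ℕ, StrictMono s ∧ ∃ a : H1Pair N, ∀ R : ℝ,
      Tendsto (fun n => ∫⁻ x in Metric.ball (0 : Eu N) R, ‖(p (s n) - a).fst x‖ₑ) atTop (𝓝 0) := by
  have : Fact ((2 : ℝ≥0∞) ≠ ⊤) := ⟨by simp⟩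
  have : SecondCountableTopology (Lp ℝ 2 (volume : Measure (Eu N))) :=
    Lp.SecondCountableTopology
  have : SecondCountableTopology (Lp (Eu N) 2 (volume : Measure (Eu N))) :=
    Lp.SecondCountableTopology
  have : TopologicalSpace.SeparableSpace (H1Pair N) :=
    (WithLp.prodContinuousLinearEquiv 2 ℝ _ _).symm.toHomeomorph.surjective.denseRange.separableSpace
      (WithLp.prodContinuousLinearEquiv 2 ℝ _ _).symm.continuous
  obtain ⟨s, hs, a, haC, hlim⟩ := exists_weak_subseq hC
  have hcl : IsClosed (h1Submodule N : Set (H1Pair N)) := isClosed_setOf_isWeakGrad_pair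
  have : CompleteSpace (h1Submodule N) := hcl.completeSpace_coe
  -- A closed subspace equals its double orthogonal complement, hence is weakly closed.
  have ha : a ∈ h1Submodule N := by
    rw [← (h1Submodule N).orthogonal_orthogonal, Submodule.mem_orthogonal]
    intro y hy
    have h1 := hlim y
    have h2 : ∀ n, ⟪p (s n), y⟫ = 0 := fun n => hy _ (hp _)
    simp only [h2] at h1
    rw [real_inner_comm]
    exact tendsto_nhds_unique h1 tendsto_const_nhds
  refine ⟨s, hs, a, fun R => ?_⟩
  set q : ℕ → H1Pair N := fun n => p (s n) - a with hq
  have hqm : ∀ n, IsWeakGrad (q n).fst (q n).snd := fun n =>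
    (h1Submodule N).sub_mem (hp _) ha
  have hqC : ∀ n, ‖q n‖ ≤ 2 * C := fun n => by
    have := norm_sub_le (p (s n)) a
    have := hC (s n)
    linarith
  have hC0 : 0 ≤ C := (norm_nonneg _).trans haC
  set V := volume (Metric.ball (0 : Eu N) R)
  have hV : V ≠ ⊤ := measure_ball_lt_top.ne
  -- For fixed `ε` each average is an inner product with an indicator, so it tends to zero pointwise
  -- by weak convergence; its bound is uniform in `x`, and dominated convergence applies.
  have havg : ∀ ε : ℝ, 0 < ε → Tendsto (fun n => ∫⁻ x in Metric.ball (0 : Eu N) R,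
      ‖∫ y in Metric.ball (0 : Eu N) ε, (q n).fst (x + y)‖ₑ) atTop (𝓝 0) := by
    intro ε hε
    have hin : ∀ n x, ∫ y in Metric.ball (0 : Eu N) ε, (q n).fst (x + y)
        = ⟪q n, WithLp.toLp 2 (indicatorConstLp 2 (measurableSet_ball (x := x) (ε := ε))
          measure_ball_lt_top.ne (1 : ℝ), 0)⟫ := by
      intro n x
      rw [WithLp.prod_inner_apply]
      simp only [inner_zero_right, add_zero]
      rw [real_inner_comm, L2.inner_indicatorConstLp_one, ← integral_indicator
        Metric.isOpen_ball.measurableSet, ← integral_indicator Metric.isOpen_ball.measurableSet,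
        ← integral_add_left_eq_self (Set.indicator (Metric.ball x ε) _) x]
      refine integral_congr_ae (.of_forall fun y => ?_)
      simp only [Set.indicator, Metric.mem_ball, dist_zero_right, dist_self_add_left]
      rfl
    have hz : (0 : ℝ≥0∞) = ∫⁻ x in Metric.ball (0 : Eu N) R, 0 := by simp
    rw [hz]
    refine tendsto_lintegral_of_dominated_convergence
      (fun _ => ENNReal.ofReal (2 * C * volume.real (Metric.ball (0 : Eu N) ε) ^ (1 / 2 : ℝ)))
      (fun n => ?_) (fun n => .of_forall fun x => ?_) ?_ (.of_forall fun x => ?_)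
    · have hdp : StronglyMeasurable fun z : Eu N × Eu N => (q n).fst (z.1 + z.2) :=
        (Lp.stronglyMeasurable _).comp_measurable (measurable_fst.add measurable_snd)
      exact (hdp.integral_prod_right' (ν := volume.restrict (Metric.ball (0 : Eu N) ε))).enorm
    · simp only [hin]
      rw [← ofReal_norm]
      refine ENNReal.ofReal_le_ofReal ((norm_inner_le_norm _ _).trans ?_)
      refine mul_le_mul (hqC n) ?_ (norm_nonneg _) (by positivity)
      rw [WithLp.norm_toLp_fst, norm_indicatorConstLp (by norm_num) (by norm_num), Measure.addHaar_real_ball_center]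
      simp
    · rw [setLIntegral_const]
      exact ENNReal.mul_ne_top ENNReal.ofReal_ne_top hV
    · simp only [hin]
      have h1 := (hlim (WithLp.toLp 2 (indicatorConstLp 2 (measurableSet_ball (x := x) (ε := ε))
          measure_ball_lt_top.ne (1 : ℝ), 0))).sub_const
          ⟪a, WithLp.toLp 2 (indicatorConstLp 2 (measurableSet_ball (x := x) (ε := ε))
          measure_ball_lt_top.ne (1 : ℝ), 0)⟫
      rw [sub_self] at h1
      simp only [hq, inner_sub_left]
      simpa using h1.enorm
  rw [ENNReal.tendsto_nhds_zero]
  intro δ hδ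
  have hδ2 : 0 < δ / 2 := ENNReal.half_pos hδ.ne'
  have hsmall : Tendsto (fun ε : ℝ => ENNReal.ofReal (ε * (2 * C)) * V ^ (1 / 2 : ℝ))
      (𝓝[>] 0) (𝓝 0) := by
    have h1 : Tendsto (fun ε : ℝ => ENNReal.ofReal (ε * (2 * C))) (𝓝[>] 0) (𝓝 0) := by
      have : Continuous fun ε : ℝ => ENNReal.ofReal (ε * (2 * C)) :=
        ENNReal.continuous_ofReal.comp (by fun_prop)
      simpa using (this.tendsto 0).mono_left nhdsWithin_le_nhds
    have h2 := ENNReal.Tendsto.mul_const (b := V ^ (1 / 2 : ℝ)) h1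
      (Or.inr (ENNReal.rpow_ne_top_of_nonneg (by norm_num) hV))
    simpa using h2
  -- First `ε` is chosen to make the translation error small uniformly in `n`; then `n` is taken
  -- large for the averages.
  obtain ⟨ε, hε1, hε⟩ := ((hsmall.eventually_le_const hδ2).and self_mem_nhdsWithin).exists
  have hε0 : (0 : ℝ) < ε := hε
  set W := volume (Metric.ball (0 : Eu N) ε)
  have hW0 : W ≠ 0 := (Metric.measure_ball_pos volume 0 hε0).ne'
  have hWt : W ≠ ⊤ := measure_ball_lt_top.ne
  have hWδ : 0 < W * (δ / 2) := ENNReal.mul_pos hW0 hδ2.ne'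
  filter_upwards [(havg ε hε0).eventually_le_const hWδ] with n hn
  have h1 := measure_mul_lintegral_le_average (hqm n) hε0.le R
  have h2 : ENNReal.ofReal (ε * ‖(q n).snd‖) * V ^ (1 / 2 : ℝ) ≤ δ / 2 := by
    refine le_trans ?_ hε1
    gcongr
    exact (WithLp.norm_snd_le _ (q n)).trans (hqC n)
  have h3 : W * ∫⁻ x in Metric.ball (0 : Eu N) R, ‖(q n).fst x‖ₑ ≤ W * δ := by
    refine h1.trans ?_
    calc _ ≤ W * (δ / 2) + W * (δ / 2) := by gcongr
      _ = W * δ := by rw [← mul_add, ENNReal.add_halves]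
  exact (ENNReal.mul_le_mul_iff_right hW0 hWt).1 h3

/-! ### Tightness -/

theorem tendsto_setLIntegral_compl_ball (ν : Measure (Eu N)) {g : Eu N → ℝ≥0∞}
    (hg : ∫⁻ x, g x ∂ν ≠ ⊤) :
    Tendsto (fun n : ℕ => ∫⁻ x in (Metric.ball (0 : Eu N) (n + 1))ᶜ, g x ∂ν) atTop (𝓝 0) := by
  have hm : ∀ n : ℕ, MeasurableSet (Metric.ball (0 : Eu N) ((n : ℝ) + 1))ᶜ := fun n =>
    measurableSet_ball.compl
  have h := tendsto_measure_iInter_atTop (μ := ν.withDensity g)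
    (s := fun n : ℕ => (Metric.ball (0 : Eu N) ((n : ℝ) + 1))ᶜ)
    (fun n => (hm n).nullMeasurableSet) (fun a b hab => Set.compl_subset_compl.2
      (Metric.ball_subset_ball (by gcongr))) ⟨0, by
        rw [withDensity_apply _ (hm 0)]
        exact ne_top_of_le_ne_top hg (setLIntegral_le_lintegral _ _)⟩
  have he : ⋂ n : ℕ, (Metric.ball (0 : Eu N) ((n : ℝ) + 1))ᶜ = ∅ := by
    refine Set.eq_empty_of_forall_notMem fun x hx => ?_
    obtain ⟨n, hn⟩ := exists_nat_gt ‖x‖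
    refine Set.mem_iInter.1 hx n ?_
    rw [mem_ball_zero_iff]
    linarith
  rw [he, measure_empty] at h
  exact h.congr fun n => withDensity_apply _ (hm n)

/-- The `L²` mass of `f` outside the ball of radius `n + 1`. -/
def l2Tail {F : Type*} [NormedAddCommGroup F] {ν : Measure (Eu N)} (f : Lp F 2 ν) (n : ℕ) : ℝ :=
  (eLpNorm f 2 (ν.restrict (Metric.ball (0 : Eu N) (n + 1))ᶜ)).toReal

theorem tendsto_l2Tail {F : Type*} [NormedAddCommGroup F] {ν : Measure (Eu N)} (f : Lp F 2 ν) :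
    Tendsto (l2Tail f) atTop (𝓝 0) := by
  have hfin : ∫⁻ x, ‖f x‖ₑ ^ 2 ∂ν ≠ ⊤ := by
    rw [← eLpNorm_two_sq]
    exact ENNReal.pow_ne_top (Lp.eLpNorm_ne_top f)
  have h1 := tendsto_setLIntegral_compl_ball ν hfin
  have h2 := ((ENNReal.continuous_rpow_const (y := 1 / 2)).tendsto 0).comp h1
  have h3 : Tendsto (fun n : ℕ => eLpNorm f 2 (ν.restrict (Metric.ball (0 : Eu N) (n + 1))ᶜ))
      atTop (𝓝 0) := by
    rw [ENNReal.zero_rpow_of_pos (by norm_num)] at h2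
    refine h2.congr fun n => ?_
    rw [Function.comp_apply, ← eLpNorm_two_sq, ← ENNReal.rpow_natCast, ← ENNReal.rpow_mul]
    norm_num
  rw [← ENNReal.toReal_zero]
  exact (ENNReal.tendsto_toReal (by simp)).comp h3

/-- Since `g` vanishes on the ball, `f` may be replaced by its restriction to the complement before
Cauchy–Schwarz. -/
theorem inner_le_l2Tail_mul {F : Type*} [NormedAddCommGroup F] [InnerProductSpace ℝ F]
    {ν : Measure (Eu N)} (f g : Lp F 2 ν) (n : ℕ)
    (hg : ∀ᵐ x ∂ν, x ∈ Metric.ball (0 : Eu N) (n + 1) → g x = 0) :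
    ⟪f, g⟫ ≤ l2Tail f n * ‖g‖ := by
  set A := (Metric.ball (0 : Eu N) (n + 1))ᶜ
  have hA : MeasurableSet A := measurableSet_ball.compl
  have hm : MemLp (A.indicator f) 2 ν := (Lp.memLp f).indicator hA
  have e : ⟪f, g⟫ = ⟪hm.toLp _, g⟫ := by
    rw [L2.inner_def, L2.inner_def]
    refine integral_congr_ae ?_
    filter_upwards [hg, hm.coeFn_toLp] with x h1 h2
    rw [h2]
    by_cases hx : x ∈ Metric.ball (0 : Eu N) (n + 1)
    · simp [h1 hx]
    · rw [Set.indicator_of_mem (show x ∈ A from hx)]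
  rw [e]
  refine (real_inner_le_norm _ _).trans_eq ?_
  rw [Lp.norm_toLp, eLpNorm_indicator_eq_eLpNorm_restrict hA]
  rfl

/-- If `H¹_μ` embeds continuously in `L¹`, then bounded sets of `H¹_μ` are tight in `L¹`. -/
theorem exists_tight (hμ : IsCapacitary μ) (h : EmbedsContinuouslyL1 μ) :
    ∃ τ : ℕ → ℝ, Tendsto τ atTop (𝓝 0) ∧ ∀ (n : ℕ) u k, IsRep μ u k →
      ∫⁻ x in (Metric.ball (0 : Eu N) (2 * (n + 1)))ᶜ, ‖u x‖ₑ ≤ ENNReal.ofReal (τ n * ‖k‖) := by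
  obtain ⟨C, hC⟩ := h
  set K := vanishingSpace μ (∅ : Set (Eu N)) with hK
  have : CompleteSpace K := (isClosed_vanishingSpace hμ _).completeSpace_coe
  have hmem : ∀ k : K, Integrable (k : H1muPair μ).fst.fst volume ∧
      |∫ x, (k : H1muPair μ).fst.fst x| ≤ C * ‖k‖ := by
    rintro ⟨k, u, hu, -⟩
    obtain ⟨h1, h2⟩ := hC u hu.memH1mu
    have hi : Integrable u volume := memLp_one_iff_integrable.1 h1
    refine ⟨hi.congr hu.2.1.1, ?_⟩
    rw [← integral_congr_ae hu.2.1.1]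
    refine (abs_integral_le_integral_abs).trans ?_
    rw [eLpNorm_one_eq_ofReal hi, hu.h1muNorm_eq, ← ofReal_norm, ← ENNReal.ofReal_coe_nnreal,
      ← ENNReal.ofReal_mul C.coe_nonneg, ENNReal.ofReal_le_ofReal_iff (by positivity)] at h2
    exact h2
  let F : K →ₗ[ℝ] ℝ :=
    { toFun := fun k => ∫ x, (k : H1muPair μ).fst.fst x
      map_add' := by
        intro k l
        rw [← integral_add (hmem k).1 (hmem l).1]
        exact integral_congr_ae (Lp.coeFn_add (k : H1muPair μ).fst.fst (l : H1muPair μ).fst.fst)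
      map_smul' := by
        intro c k
        rw [RingHom.id_apply, smul_eq_mul, ← integral_const_mul]
        exact integral_congr_ae (Lp.coeFn_smul c (k : H1muPair μ).fst.fst) }
  -- By Riesz, `W` represents `u ↦ ∫ u` on all of `H¹_μ`: it plays the role of the torsion function
  -- of the whole space.
  set W : K := (InnerProductSpace.toDual ℝ K).symm (F.mkContinuous C fun k => (hmem k).2)
  have hW : ∀ φ l, IsRep μ φ l → ⟪(W : H1muPair μ), l⟫ = ∫ x, φ x := by
    intro φ l hl
    have hlK : l ∈ K := ⟨φ, hl, vanishesQE_empty φ⟩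
    have h1 : ⟪W, (⟨l, hlK⟩ : K)⟫ = F ⟨l, hlK⟩ := InnerProductSpace.toDual_symm_apply
    rw [Submodule.coe_inner] at h1
    rw [h1, integral_congr_ae hl.2.1.1]
    rfl
  obtain ⟨η, M, hη⟩ := exists_cutoff N
  have hM0 : 0 ≤ M := (norm_nonneg _).trans ((hη 0).2.2.1 0)
  set w : H1muPair μ := W.1
  set τ : ℕ → ℝ := fun n => (l2Tail w.fst.fst n + l2Tail w.fst.snd n + l2Tail w.snd n) * (3 + M)
    with hτ
  refine ⟨τ, ?_, fun n u k hk => ?_⟩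
  · have := (((tendsto_l2Tail w.fst.fst).add (tendsto_l2Tail w.fst.snd)).add
      (tendsto_l2Tail w.snd)).mul_const (3 + M)
    simpa using this
  obtain ⟨k', hk', hle⟩ := hk.exists_abs
  have hχ : ContDiff ℝ ∞ (fun x => 1 - η n x) := contDiff_const.sub (hη n).1
  have hfd : ∀ x, fderiv ℝ (fun x => 1 - η n x) x = -fderiv ℝ (η n) x := fun x =>
    fderiv_const_sub 1
  obtain ⟨l, hl, hlle, hvan⟩ := hk'.exists_mul hχ
    (fun x => abs_le.2 ⟨by linarith [((hη n).2.1 x).2], by linarith [((hη n).2.1 x).1]⟩)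
    (M := M) (fun x => by
      rw [hfd, norm_neg]
      exact (hη n).2.2.1 x)
  -- On the open ball `1 - η n` is locally zero, so its gradient vanishes too and all three
  -- components of `l` do; only the tails of `W` enter the pairing.
  obtain ⟨v1, v2, v3⟩ := hvan (Metric.ball (0 : Eu N) (n + 1)) fun x hx => by
    have hone : η n =ᶠ[𝓝 x] fun _ => 1 := by
      filter_upwards [Metric.isOpen_ball.mem_nhds hx] with y hy
      exact (hη n).2.2.2.1 y hy
    refine ⟨by rw [(hη n).2.2.2.1 x hx, sub_self], ?_⟩
    rw [hfd, hone.fderiv_eq]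
    simp
  have hint : Integrable (fun x => (1 - η n x) * |u x|) volume :=
    memLp_one_iff_integrable.1 (hC _ hl.memH1mu).1
  have hnn : ∀ x, 0 ≤ (1 - η n x) * |u x| := fun x =>
    mul_nonneg (by linarith [((hη n).2.1 x).2]) (abs_nonneg _)
  calc ∫⁻ x in (Metric.ball (0 : Eu N) (2 * (n + 1)))ᶜ, ‖u x‖ₑ
      ≤ ∫⁻ x in (Metric.ball (0 : Eu N) (2 * (n + 1)))ᶜ,
          ENNReal.ofReal ((1 - η n x) * |u x|) := by
        refine setLIntegral_mono' measurableSet_ball.compl fun x hx => ?_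
        rw [(hη n).2.2.2.2 x hx, sub_zero, one_mul, Real.enorm_eq_ofReal_abs]
    _ ≤ ∫⁻ x, ENNReal.ofReal ((1 - η n x) * |u x|) := setLIntegral_le_lintegral _ _
    _ = ENNReal.ofReal (∫ x, (1 - η n x) * |u x|) :=
        (ofReal_integral_eq_lintegral_ofReal hint (.of_forall hnn)).symm
    _ = ENNReal.ofReal ⟪w, l⟫ := by rw [hW _ l hl]
    _ ≤ ENNReal.ofReal (τ n * ‖k‖) := by
        refine ENNReal.ofReal_le_ofReal ?_
        have t1 := inner_le_l2Tail_mul w.fst.fst l.fst.fst n v1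
        have t2 := inner_le_l2Tail_mul w.fst.snd l.fst.snd n v2
        have t3 := inner_le_l2Tail_mul w.snd l.snd n v3
        have c0 : ‖l.fst‖ ≤ ‖l‖ := WithLp.norm_fst_le _ l
        have c1 : ‖l.fst.fst‖ ≤ ‖l‖ := (WithLp.norm_fst_le _ l.fst).trans c0
        have c2 : ‖l.fst.snd‖ ≤ ‖l‖ := (WithLp.norm_snd_le _ l.fst).trans c0
        have c3 : ‖l.snd‖ ≤ ‖l‖ := WithLp.norm_snd_le _ l
        have n1 : 0 ≤ l2Tail w.fst.fst n := ENNReal.toReal_nonneg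
        have n2 : 0 ≤ l2Tail w.fst.snd n := ENNReal.toReal_nonneg
        have n3 : 0 ≤ l2Tail w.snd n := ENNReal.toReal_nonneg
        have hin : ⟪w, l⟫ = ⟪w.fst.fst, l.fst.fst⟫ + ⟪w.fst.snd, l.fst.snd⟫ + ⟪w.snd, l.snd⟫ :=
          rfl
        have hl3 : ‖l‖ ≤ (3 + M) * ‖k‖ := hlle.trans (by gcongr)
        calc ⟪w, l⟫ ≤ l2Tail w.fst.fst n * ‖l‖ + l2Tail w.fst.snd n * ‖l‖
              + l2Tail w.snd n * ‖l‖ := by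
              rw [hin]
              gcongr
              · exact t1.trans (by gcongr)
              · exact t2.trans (by gcongr)
              · exact t3.trans (by gcongr)
          _ = (l2Tail w.fst.fst n + l2Tail w.fst.snd n + l2Tail w.snd n) * ‖l‖ := by ring
          _ ≤ (l2Tail w.fst.fst n + l2Tail w.fst.snd n + l2Tail w.snd n) * ((3 + M) * ‖k‖) := by
              gcongr
          _ = τ n * ‖k‖ := by rw [hτ]; ring

/-! ### Compactness from tightness and local convergence -/

/-- A continuous embedding of `H¹_μ` in `L¹` is compact. -/
theorem embedsCompactlyL1_of_embedsContinuouslyL1 (hμ : IsCapacitary μ)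
    (h : EmbedsContinuouslyL1 μ) : EmbedsCompactlyL1 μ := by
  obtain ⟨τ, hτ, htight⟩ := exists_tight hμ h
  obtain ⟨C, hC⟩ := h
  refine ⟨fun u hu => (hC u hu).1, fun B u hu => ?_⟩
  choose k hk using fun n => (hu n).1.exists_isRep
  have hkB : ∀ n, ‖k n‖ ≤ B := by
    intro n
    have := (hu n).2
    rw [(hk n).h1muNorm_eq, enorm_le_coe] at this
    exact_mod_cast this
  obtain ⟨s, hs, a, hloc⟩ := exists_subseq_tendsto_ball (p := fun n => (k n).fst) (C := B)
    (fun n => (hk n).2.1.2.congr (hk n).2.1.1 ae_eq_rfl)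
    (fun n => (WithLp.norm_fst_le _ (k n)).trans (hkB n))
  set f : Eu N → ℝ := ⇑a.fst with hf
  have hfm : AEStronglyMeasurable f volume := Lp.aestronglyMeasurable _
  have hum : ∀ n, AEStronglyMeasurable (u n) volume := fun n => (hk n).memLp.1
  have hloc' : ∀ R : ℝ, Tendsto (fun n => ∫⁻ x in Metric.ball (0 : Eu N) R, ‖u (s n) x - f x‖ₑ)
      atTop (𝓝 0) := by
    intro R
    refine (hloc R).congr fun n => lintegral_congr_ae (ae_restrict_of_ae ?_)
    filter_upwards [(hk (s n)).2.1.1, Lp.coeFn_sub (k (s n)).fst.fst a.fst] with x h1 h2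
    have h3 : ((k (s n)).fst - a).fst x = (k (s n)).fst.fst x - a.fst x := h2
    rw [h3, h1]
  have hD : ∀ n, eLpNorm (u n) 1 volume ≤ C * B := fun n =>
    ((hC _ (hu n).1).2).trans (by gcongr; exact (hu n).2)
  have hball : ∀ R : ℝ, ∫⁻ x in Metric.ball (0 : Eu N) R, ‖f x‖ₑ ≤ C * B := by
    intro R
    have h1 : ∀ n, ∫⁻ x in Metric.ball (0 : Eu N) R, ‖f x‖ₑ
        ≤ (∫⁻ x in Metric.ball (0 : Eu N) R, ‖u (s n) x - f x‖ₑ) + C * B := by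
      intro n
      calc ∫⁻ x in Metric.ball (0 : Eu N) R, ‖f x‖ₑ
          ≤ ∫⁻ x in Metric.ball (0 : Eu N) R, (‖u (s n) x - f x‖ₑ + ‖u (s n) x‖ₑ) := by
            refine lintegral_mono fun x => ?_
            have := enorm_sub_le (a := u (s n) x) (b := u (s n) x - f x)
            rw [sub_sub_cancel] at this
            rwa [add_comm] at this
        _ = (∫⁻ x in Metric.ball (0 : Eu N) R, ‖u (s n) x - f x‖ₑ)
            + ∫⁻ x in Metric.ball (0 : Eu N) R, ‖u (s n) x‖ₑ :=
            lintegral_add_left' (((hum _).sub hfm).restrict.enorm) _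
        _ ≤ _ := by
            gcongr
            refine (setLIntegral_le_lintegral _ _).trans ?_
            rw [← eLpNorm_one_eq_lintegral_enorm]
            exact hD _
    have h2 := (hloc' R).add_const (C * B : ℝ≥0∞)
    rw [zero_add] at h2
    exact ge_of_tendsto' h2 h1
  -- The local limit is only known to be in `L²`; its `L¹` norm is bounded through balls, by local
  -- convergence and the uniform bound on `u n`.
  have hf1 : eLpNorm f 1 volume ≤ C * B := by
    refine lintegral_enorm_le_of_tendsto
      (u := fun n : ℕ => (Metric.ball (0 : Eu N) n).indicator f)
      (fun n => hfm.indicator measurableSet_ball) (.of_forall fun x => ?_) fun n => ?_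
    · refine tendsto_const_nhds.congr' ?_
      obtain ⟨m, hm⟩ := exists_nat_gt ‖x‖
      filter_upwards [eventually_ge_atTop m] with n hn
      have : (m : ℝ) ≤ n := by exact_mod_cast hn
      rw [Set.indicator_of_mem (mem_ball_zero_iff.2 (hm.trans_le this))]
    · rw [eLpNorm_indicator_eq_eLpNorm_restrict measurableSet_ball, eLpNorm_one_eq_lintegral_enorm]
      exact hball n
  have hfin : eLpNorm f 1 volume < ⊤ :=
    hf1.trans_lt (ENNReal.mul_lt_top ENNReal.coe_lt_top ENNReal.coe_lt_top)
  refine ⟨s, hs, f, ⟨hfm, hfin⟩, ENNReal.tendsto_nhds_zero.2 fun δ hδ => ?_⟩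
  have hδ3 : 0 < δ / 3 := ENNReal.div_pos hδ.ne' (by norm_num)
  -- The absolute value is taken because `exists_tight` does not assert that `τ` is nonnegative.
  have ht1 : Tendsto (fun n => ENNReal.ofReal (|τ n| * B)) atTop (𝓝 0) := by
    have h1 := hτ.abs.mul_const (B : ℝ)
    rw [abs_zero, zero_mul] at h1
    rw [← ENNReal.ofReal_zero]
    exact (ENNReal.continuous_ofReal.tendsto 0).comp h1
  rw [eLpNorm_one_eq_lintegral_enorm] at hfin
  have ht2 := tendsto_setLIntegral_compl_ball volume hfin.ne
  -- One radius makes the tails of all `u (s n)` and of `f` at most `δ / 3`; local convergence on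
  -- the ball supplies the last third.
  obtain ⟨m, hm1, hm2⟩ := ((ht1.eventually_le_const hδ3).and (ht2.eventually_le_const hδ3)).exists
  filter_upwards [(hloc' (2 * ((m : ℝ) + 1))).eventually_le_const hδ3] with n hn
  set D := Metric.ball (0 : Eu N) (2 * ((m : ℝ) + 1)) with hDdef
  have hDm : MeasurableSet D := measurableSet_ball
  have hu1 : ∫⁻ x in Dᶜ, ‖u (s n) x‖ₑ ≤ δ / 3 := by
    refine (htight m _ _ (hk (s n))).trans ((ENNReal.ofReal_le_ofReal ?_).trans hm1)
    exact mul_le_mul (le_abs_self _) (hkB _) (norm_nonneg _) (abs_nonneg _)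
  have hu2 : ∫⁻ x in Dᶜ, ‖f x‖ₑ ≤ δ / 3 := by
    refine (lintegral_mono_set (Set.compl_subset_compl.2 (Metric.ball_subset_ball ?_))).trans hm2
    linarith [m.cast_nonneg (α := ℝ)]
  calc eLpNorm (u (s n) - f) 1 volume = ∫⁻ x, ‖u (s n) x - f x‖ₑ := by
        rw [eLpNorm_one_eq_lintegral_enorm]
        rfl
    _ = (∫⁻ x in D, ‖u (s n) x - f x‖ₑ) + ∫⁻ x in Dᶜ, ‖u (s n) x - f x‖ₑ :=
        (lintegral_add_compl _ hDm).symm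
    _ ≤ δ / 3 + ((∫⁻ x in Dᶜ, ‖u (s n) x‖ₑ) + ∫⁻ x in Dᶜ, ‖f x‖ₑ) := by
        gcongr
        rw [← lintegral_add_left' (hum _).restrict.enorm]
        exact lintegral_mono fun x => enorm_sub_le
    _ ≤ δ / 3 + (δ / 3 + δ / 3) := by gcongr
    _ = δ := by rw [← add_assoc, ENNReal.add_thirds]

end CapacitarySobolev

end

open CapacitarySobolev in
theorem theorem3p2 (N : ℕ) (μ : Measure (Eu N)) (hμ : IsCapacitary μ) :
    (∃ w : Eu N → ℝ, IsLimitSolution μ w) ∧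
    ∀ w : Eu N → ℝ, IsLimitSolution μ w →
      (MemLp w 1 volume ↔ EmbedsContinuouslyL1 μ) ∧
      (MemLp w 1 volume ∨ EmbedsContinuouslyL1 μ → EmbedsCompactlyL1 μ) := by
  refine ⟨exists_isLimitSolution hμ, fun w hw => ?_⟩
  have key : MemLp w 1 volume ↔ EmbedsContinuouslyL1 μ :=
    ⟨embedsContinuouslyL1_of_memLp_one hw, memLp_one_of_embedsContinuouslyL1 hw⟩
  refine ⟨key, fun h => embedsCompactlyL1_of_embedsContinuouslyL1 hμ ?_⟩
  exact h.elim key.1 id
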